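/- Let $X$ and $U$ be complex Banach spaces, and let $A$ be the generator of an exponentially stable analytic semigroup $T=(T(t))_{t\ge 0}$ on $X$. Fix $a\in\rho(A)$ and let $X_{-1}$ be the completion of $X$ in the norm $\|x\|_{-1}=\|(aI-A)^{-1}x\|$; $T(t)$ and $(-A)^{-p}$ extend continuously to $X_{-1}$ (the extension of $T(t)$ is written $T_{-1}(t)$, that of $(-A)^{-p}$ is written as before). Here $(-A)^{0}=I$, $(-A)^{-\alpha}=\frac1{\Gamma(\alpha)}\int_0^\infty t^{\alpha-1}T(t)\,dt$ for $\alpha>0$, and $(-A)^{\alpha}$ is the inverse of $(-A)^{-\alpha}$, with domain $D((-A)^\alpha)=\operatorname{ran}(-A)^{-\alpha}$. For $p\ge 0$ let $X_{-p}=\{z\in X_{-1}:(-A)^{-p}z\in X\}$ with norm $\|z\|_{-p}=\|(-A)^{-p}z\|_X$. Let $p\in[0,1)$ and $B\in L(U,X_{-1})$ with $B\in L(U,X_{-p})$ (equivalently, $(-A)^{-p}B\in L(U,X)$), and let $q\ge 0$ satisfy $p+2q<1$. Then for every $x\in X$ one has $T(t)x\in D((-A)^q)$ for all $t>0$ and $t\mapsto\|(-A)^qT(t)x\|^2$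 is integrable on $(0,\infty)$, and the function $$W_q(x)=\int_0^\infty\|(-A)^qT(t)x\|^2\,dt,\qquad x\in X,$$ is a non-coercive (that is, not necessarily coercive) quadratic $L^2$-ISS Lyapunov function for the system $\dot x=Ax+Bu$. This means: 1. $B$ is $C$-admissible: for all $t\ge0$ and $u\in C([0,t],U)$ the integral $\int_0^tT_{-1}(t-s)Bu(s)\,ds$, taken in $X_{-1}$, lies in $X$. 2. $W_q:X\to[0,\infty)$ is continuous and there is $\alpha\in\mathcal K_\infty$ with $0<W_q(x)\le\alpha(\|x\|)$ for all $x\ne0$. 3. There are constants $a_3,a_4>0$ such that for all $x_0\in X$ and all $u\in C([0,\infty),U)$, with the mild solution $x(t)=T(t)x_0+\int_0^tT_{-1}(t-s)Bu(s)\,ds$, $$\limsup_{h\to0^+}\frac{W_q(x(h))-W_q(x_0)}{h}\le -a_3\|x_0\|^2+a_4\|u(0)\|_U^2 .$$ 4. $W_q$ is quadratic: $Fx:=(-A)^qT(\cdot)x$ defines an injective bounded linear operator $F\in L(X,L^2(0,\infty;X))$ with $W_q(x)=\|Fx\|^2$ for all $x\in X$. If the norm of $X$ is induced by an inner product (i.e.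 $X$ is a Hilbert space), there is moreover an injective operator $\tilde F\in L(X)$ with $W_q(x)=\|\tilde Fx\|^2$ for all $x\in X$. -/

import Mathlib

open Set Filter Topology MeasureTheory

/-- A strongly continuous semigroup `(T(t))_{t ≥ 0}` of bounded linear operators on `X`.
Only the values at `t ≥ 0` are meaningful. -/
structure C0Semigroup (X : Type*) [NormedAddCommGroup X] [NormedSpace ℂ X] where
  op : ℝ → X →L[ℂ] X
  op_zero : op 0 = ContinuousLinearMap.id ℂ X
  op_add : ∀ s t : ℝ, 0 ≤ s → 0 ≤ t → op (s + t) = (op s).comp (op t)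
  strong_cont : ∀ x : X, Tendsto (fun t => op t x) (𝓝[>] 0) (𝓝 x)

section Semigroup

variable {X : Type*} [NormedAddCommGroup X] [NormedSpace ℂ X]

/-- `A : D(A) ⊆ X → X` is the infinitesimal generator of `T`: one has `x ∈ D(A)` and `A x = y`
iff `(T(h)x - x) / h → y` as `h → 0+`. -/
def IsGenerator (A : X →ₗ.[ℂ] X) (T : C0Semigroup X) : Prop :=
  ∀ x y : X, (x, y) ∈ A.graph ↔
    Tendsto (fun h : ℝ => h⁻¹ • (T.op h x - x)) (𝓝[>] 0) (𝓝 y)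

/-- `a ∈ ρ(A)` and `R = (a I - A)⁻¹`. -/
def IsResolvent (A : X →ₗ.[ℂ] X) (a : ℂ) (R : X →L[ℂ] X) : Prop :=
  (∀ x : X, (R x, a • R x - x) ∈ A.graph) ∧ ∀ x : A.domain, R (a • (x : X) - A x) = x

/-- The open sector of half-angle `φ` around the positive real axis. -/
def sector (φ : ℝ) : Set ℂ := {z : ℂ | z ≠ 0 ∧ |z.arg| < φ}

/-- The semigroup extends analytically (in operator norm) to a sector, strongly continuously at the
vertex along a smaller sector. -/
def C0Semigroup.IsAnalytic (T : C0Semigroup X) : Prop :=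
  ∃ φ : ℝ, 0 < φ ∧ φ ≤ Real.pi / 2 ∧ ∃ S : ℂ → X →L[ℂ] X,
    (∀ t : ℝ, 0 < t → S (t : ℂ) = T.op t) ∧
    DifferentiableOn ℂ S (sector φ) ∧
    ∃ θ : ℝ, 0 < θ ∧ θ < φ ∧ ∀ x : X, Tendsto (fun z => S z x) (𝓝[sector θ] 0) (𝓝 x)

/-- `‖T(t)‖ ≤ M e^{-ω t}` for all `t ≥ 0`, with some `M, ω > 0`. -/
def C0Semigroup.IsExpStable (T : C0Semigroup X) : Prop :=
  ∃ M ω : ℝ, 0 < M ∧ 0 < ω ∧ ∀ t : ℝ, 0 ≤ t → ‖T.op t‖ ≤ M * Real.exp (-ω * t)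

/-- For `A` the generator of the exponentially stable analytic semigroup `T` and `α ≥ 0`, the bounded
operator `(-A)^{-α}`, that is the identity for `α = 0` and
`Γ(α)⁻¹ ∫₀^∞ t^{α-1} T(t) dt` for `α > 0`
(a Bochner integral in operator norm, absolutely convergent for such `T`). -/
noncomputable def C0Semigroup.negPow (T : C0Semigroup X) (α : ℝ) : X →L[ℂ] X :=
  if α = 0 then ContinuousLinearMap.id ℂ X
  else (Real.Gamma α)⁻¹ • ∫ t in Ioi (0 : ℝ), t ^ (α - 1) • T.op t

/-- The (in general unbounded) operator `(-A)^α`, `α ≥ 0`: the inverse of the injective bounded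
operator `(-A)^{-α}`, with domain the range of `(-A)^{-α}`. -/
noncomputable def C0Semigroup.posPow (T : C0Semigroup X) (α : ℝ) : X →ₗ.[ℂ] X :=
  ((T.negPow α : X →ₗ[ℂ] X).toPMap ⊤).inverse

open Classical in
/-- The vector `(-A)^α x` for `x ∈ D((-A)^α)` (and `0` for other `x`). -/
noncomputable def C0Semigroup.posPowApply (T : C0Semigroup X) (α : ℝ) (x : X) : X :=
  if h : x ∈ (T.posPow α).domain then T.posPow α ⟨x, h⟩ else 0

/-- The function `W_q(x) = ∫₀^∞ ‖(-A)^q T(t) x‖² dt`. -/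
noncomputable def lyapW (T : C0Semigroup X) (q : ℝ) (x : X) : ℝ :=
  ∫ t in Ioi (0 : ℝ), ‖T.posPowApply q (T.op t x)‖ ^ 2

/-- The vector space `X`, to be endowed with the norm `‖R x‖`. -/
def PreExtrap (_R : X →L[ℂ] X) : Type _ := X

instance (R : X →L[ℂ] X) : AddCommGroup (PreExtrap R) := inferInstanceAs (AddCommGroup X)

instance (R : X →L[ℂ] X) : Module ℂ (PreExtrap R) := inferInstanceAs (Module ℂ X)

/-- `R` as a linear map on the copy `PreExtrap R` of `X`. -/
def preExtrapMap (R : X →L[ℂ] X) : PreExtrap R →ₗ[ℂ] X := (R : X →ₗ[ℂ] X)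

noncomputable instance (R : X →L[ℂ] X) : SeminormedAddCommGroup (PreExtrap R) :=
  SeminormedAddCommGroup.induced (PreExtrap R) X (preExtrapMap R)

noncomputable instance (R : X →L[ℂ] X) : NormedSpace ℂ (PreExtrap R) :=
  NormedSpace.induced ℂ (PreExtrap R) X (preExtrapMap R)

/-- For `R = (a I - A)⁻¹`, the extrapolation space `X_{-1}`: the completion of `X` in the norm
`‖x‖_{-1} = ‖(a I - A)⁻¹ x‖`. -/
abbrev Extrap (R : X →L[ℂ] X) : Type _ := UniformSpace.Completion (PreExtrap R)

/-- The canonical embedding of `X` into `X_{-1}`. -/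
noncomputable def toExtrap (R : X →L[ℂ] X) (x : X) : Extrap R :=
  ((show PreExtrap R from x : PreExtrap R) : UniformSpace.Completion (PreExtrap R))

/-- The extension by continuity to `X_{-1}` of a bounded operator `S` on `X` that commutes with `R`.
(Such an `S` is Lipschitz for `‖·‖_{-1}`, so that the extension exists.) -/
noncomputable def extrapExt (R S : X →L[ℂ] X) : Extrap R → Extrap R :=
  UniformSpace.Completion.map (α := PreExtrap R) (β := PreExtrap R) (fun x : X => S x)

theorem norm_toExtrap (R : X →L[ℂ] X) (x : X) : ‖toExtrap R x‖ = ‖R x‖ :=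
  UniformSpace.Completion.norm_coe (E := PreExtrap R) x

theorem extrapExt_uniformContinuous (R S : X →L[ℂ] X) : UniformContinuous (extrapExt R S) :=
  UniformSpace.Completion.uniformContinuous_map

theorem extrapExt_toExtrap (R S : X →L[ℂ] X) (h : ∀ x, R (S x) = S (R x)) (x : X) :
    extrapExt R S (toExtrap R x) = toExtrap R (S x) := by
  have hl : LipschitzWith (α := PreExtrap R) (β := PreExtrap R) ‖S‖₊ (fun x : X => S x) := by
    refine LipschitzWith.of_dist_le_mul fun y z => ?_
    have key : ∀ y z : X, dist (R (S y)) (R (S z)) ≤ ‖S‖ * dist (R y) (R z) := fun y z => by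
      rw [h, h]
      exact S.lipschitz.dist_le_mul _ _
    exact key y z
  exact UniformSpace.Completion.map_coe hl.uniformContinuous x

end Semigroup

section System

variable {X U : Type*} [NormedAddCommGroup X] [NormedSpace ℂ X]
  [NormedAddCommGroup U] [NormedSpace ℂ U]

/-- `B ∈ L(U, X_{-1})` belongs to `L(U, X_{-p})`. Here `X_{-p}` is the space of all `z ∈ X_{-1}` such
that (the extension to `X_{-1}` of) `(-A)^{-p}` maps `z` to some `x ∈ X`, with `‖z‖_{-p} = ‖x‖`;
equivalently, `(-A)^{-p} B ∈ L(U, X)`. -/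
def MapsBoundedlyInto (T : C0Semigroup X) (R : X →L[ℂ] X) (p : ℝ) (B : U →L[ℂ] Extrap R) : Prop :=
  ∃ C : ℝ, ∀ v : U, ∃ x : X, extrapExt R (T.negPow p) (B v) = toExtrap R x ∧ ‖x‖ ≤ C * ‖v‖

/-- The integrand `s ↦ T_{-1}(t-s) B u(s)` with values in `X_{-1}`. -/
noncomputable def inputIntegrand (T : C0Semigroup X) (R : X →L[ℂ] X) (B : U →L[ℂ] Extrap R)
    (u : ℝ → U) (t s : ℝ) : Extrap R :=
  extrapExt R (T.op (t - s)) (B (u s))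

/-- `B` is `C`-admissible: for all `t ≥ 0` and `u ∈ C([0,t], U)`, the integral
`∫₀ᵗ T_{-1}(t-s) B u(s) ds` (which exists in `X_{-1}`) lies in `X`. -/
def IsCAdmissible (T : C0Semigroup X) (R : X →L[ℂ] X) (B : U →L[ℂ] Extrap R) : Prop :=
  ∀ (t : ℝ), 0 ≤ t → ∀ u : ℝ → U, ContinuousOn u (Icc 0 t) →
    IntervalIntegrable (inputIntegrand T R B u t) volume 0 t ∧
    ∃ y : X, toExtrap R y = ∫ s in (0 : ℝ)..t, inputIntegrand T R B u t s

/-- `x : [0,∞) → X` is the mild solution of `ẋ = A x + B u`, `x(0) = x₀`: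
`x(t) = T(t) x₀ + ∫₀ᵗ T_{-1}(t-s) B u(s) ds`, read in `X_{-1}`. -/
def IsMildSolution (T : C0Semigroup X) (R : X →L[ℂ] X) (B : U →L[ℂ] Extrap R)
    (u : ℝ → U) (x₀ : X) (x : ℝ → X) : Prop :=
  ∀ t : ℝ, 0 ≤ t →
    toExtrap R (x t) = toExtrap R (T.op t x₀) + ∫ s in (0 : ℝ)..t, inputIntegrand T R B u t s

/-- Comparison functions of class `K_∞` (only the values on `[0,∞)` are meaningful). -/
def IsClassKInf (α : ℝ → ℝ) : Prop :=
  ContinuousOn α (Ici 0) ∧ StrictMonoOn α (Ici 0) ∧ α 0 = 0 ∧ Tendsto α atTop atTop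

/-- The right-hand upper Dini derivative at `t = 0` of `t ↦ V(x(t))`, where `x(0) = x₀`. -/
noncomputable def diniDeriv (V : X → ℝ) (x : ℝ → X) (x₀ : X) : EReal :=
  limsup (fun h : ℝ => (((V (x h) - V x₀) / h : ℝ) : EReal)) (𝓝[>] 0)

/-- `V` is a (not necessarily coercive) `L^r`-ISS Lyapunov function for the system with semigroup `T`
and input operator `B`. -/
structure IsLrISSLyapunov (T : C0Semigroup X) (R : X →L[ℂ] X) (B : U →L[ℂ] Extrap R)
    (r : ℝ) (V : X → ℝ) : Prop where
  admissible : IsCAdmissible T R B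
  continuous : Continuous V
  nonneg : ∀ x, 0 ≤ V x
  bounds : ∃ α : ℝ → ℝ, IsClassKInf α ∧ ∀ x : X, x ≠ 0 → 0 < V x ∧ V x ≤ α ‖x‖
  dissipation : ∃ a₃ a₄ : ℝ, 0 < a₃ ∧ 0 < a₄ ∧
    ∀ (x₀ : X) (u : ℝ → U) (x : ℝ → X), ContinuousOn u (Ici 0) →
      IsMildSolution T R B u x₀ x →
      diniDeriv V x x₀ ≤ ((-a₃ * ‖x₀‖ ^ 2 + a₄ * ‖u 0‖ ^ r : ℝ) : EReal)

end System

/-! ### Abel kernels and their composition. -/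

section Kernel

/-! After smoothing by `T(t)`, `t > 0`, the fractional power becomes an explicit bounded operator.
Formally `(-A)^α = (-A) (-A)^{-(1-α)}` and `A T(t) = T'(t)`, which suggests `(-A)^α T(t) = -Γ(1-α)⁻¹
∫ s^{-α} T'(t+s) ds`; this is `fracOp`. No functional calculus is needed: `negPow_comp_fracOp`
checks directly, by composing the kernels `r^{α-1}` and `s^{-α}`, that `(-A)^{-α}` sends it to
`T(t)`. Cauchy's estimate in the sector gives `‖T'(t)‖ ≤ C t⁻¹ e^{-ωt}` (`exists_exp_bounds`), hence
`‖(-A)^α T(t)‖ ≤ K t^{-α} e^{-ωt}` (`exists_norm_fracOp_le`). For `2q < 1` this is square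
integrable, so `W_q` is the squared norm of a bounded `F` into `L²`. The operator `F` is injective
because `(-A)^{-q}` recovers `T(t)x`, which tends to `x`. On a Hilbert space the square root of
`F*F` replaces `F`.

The space `X_{-1}` is handled through the isometry `J` into `X` that extends the resolvent. With `b
= (-A)^{-p} B`, the input part of the mild solution is `∫ (-A)^p T(t-s) b u(s) ds`, which converges
in `X` because `p < 1` (`toExtrap_integral_fracOp`). This is admissibility.

Dissipation rests on `exists_lyap_increment_le`. Over a time `r` the free motion shifts the integral
and loses `∫₀ʳ ‖(-A)^q T(t)x₀‖² dt`, at least a constant times `∫₀ʳ ‖T(t)x₀‖² dt`. If `y` is the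
input contribution and `m` bounds `b u`, then letting `T(t)` absorb both powers gives `‖(-A)^q
T(t)y‖ ≲ t^{-(p+q)} m r`. Against `‖(-A)^q T(t)x₀‖ ≲ t^{-q} ‖x₀‖` the cross term has weight
`t^{-(p+2q)}`, integrable since `p + 2q < 1`, and is `O(r ‖x₀‖ m)`. The term quadratic in `y` is
`O(r^{2-p})`. Dividing by `r`, letting `r → 0` and applying Young's inequality finishes the
estimate. -/

theorem integrableOn_rpow_neg_mul_exp {α ω : ℝ} (hα : α < 1) (hω : 0 < ω) :
    IntegrableOn (fun t : ℝ => t ^ (-α) * Real.exp (-ω * t)) (Ioi 0) := by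
  have h := integrableOn_rpow_mul_exp_neg_mul_rpow (p := 1) (s := -α) (b := ω)
    (by linarith) one_pos hω
  simpa using h

theorem integrableOn_rpow_neg_mul_inv_one_add {α : ℝ} (h0 : 0 < α) (h1 : α < 1) :
    IntegrableOn (fun σ : ℝ => σ ^ (-α) * (1 + σ)⁻¹) (Ioi 0) := by
  have hc : ContinuousOn (fun σ : ℝ => σ ^ (-α) * (1 + σ)⁻¹) (Ioi 0) := by
    intro σ (hσ : 0 < σ)
    have : 1 + σ ≠ 0 := by positivity
    exact ((Real.continuousAt_rpow_const _ _ (Or.inl hσ.ne')).mul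
      ((continuousAt_const.add continuousAt_id).inv₀ this)).continuousWithinAt
  rw [← Ioc_union_Ioi_eq_Ioi (zero_le_one (α := ℝ)), integrableOn_union]
  constructor
  · have h : IntegrableOn (fun σ : ℝ => σ ^ (-α)) (Ioc 0 1) := by
      rw [← intervalIntegrable_iff_integrableOn_Ioc_of_le zero_le_one]
      exact intervalIntegral.intervalIntegrable_rpow' (by linarith)
    refine Integrable.mono' h
      ((hc.mono fun x hx => hx.1).aestronglyMeasurable measurableSet_Ioc) ?_
    filter_upwards [ae_restrict_mem measurableSet_Ioc] with σ hσ
    have h3 : 0 ≤ σ ^ (-α) := Real.rpow_nonneg hσ.1.le _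
    have h4 : (1 + σ)⁻¹ ≤ 1 := inv_le_one_of_one_le₀ (by linarith [hσ.1])
    have h5 : 0 ≤ (1 + σ)⁻¹ := inv_nonneg.2 (by linarith [hσ.1])
    rw [Real.norm_of_nonneg (mul_nonneg h3 h5)]
    exact mul_le_of_le_one_right h3 h4
  · have h : IntegrableOn (fun σ : ℝ => σ ^ (-α - 1)) (Ioi 1) volume :=
      integrableOn_Ioi_rpow_of_lt (by linarith) one_pos
    refine Integrable.mono' h
      ((hc.mono (Ioi_subset_Ioi zero_le_one)).aestronglyMeasurable measurableSet_Ioi) ?_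
    filter_upwards [ae_restrict_mem measurableSet_Ioi] with σ (hσ : 1 < σ)
    have hp : 0 < σ := zero_lt_one.trans hσ
    have h5 : 0 ≤ (1 + σ)⁻¹ := inv_nonneg.2 (by linarith)
    have h3 : 0 ≤ σ ^ (-α) := Real.rpow_nonneg hp.le _
    rw [Real.norm_of_nonneg (mul_nonneg h3 h5), Real.rpow_sub hp, Real.rpow_one, div_eq_mul_inv]
    have h6 : (1 + σ)⁻¹ ≤ σ⁻¹ := inv_anti₀ hp (by linarith)
    exact mul_le_mul_of_nonneg_left h6 h3

variable {E : Type*} [NormedAddCommGroup E] [NormedSpace ℝ E]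

theorem integral_rpow_smul_integral_rpow_smul_aux [CompleteSpace E] {H : ℝ → E} {α C ω : ℝ}
    (h0 : 0 < α) (h1 : α < 1) (hω : 0 < ω) (hH : ContinuousOn H (Ioi 0))
    (hb : ∀ v, 0 < v → ‖H v‖ ≤ C * Real.exp (-ω * v)) :
    ∫ r in Ioi (0 : ℝ), r ^ (α - 1) • ∫ s in Ioi (0 : ℝ), s ^ (-α) • H (r + s) =
      (∫ σ in Ioi (0 : ℝ), σ ^ (-α) * (1 + σ)⁻¹) • ∫ v in Ioi (0 : ℝ), H v := by
  have hint : IntegrableOn H (Ioi 0) := by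
    refine Integrable.mono' ((exp_neg_integrableOn_Ioi 0 hω).const_mul C)
      (hH.aestronglyMeasurable measurableSet_Ioi) ?_
    filter_upwards [ae_restrict_mem measurableSet_Ioi] with v hv using hb v hv
  have hint' : ∀ σ : ℝ, 0 < σ → IntegrableOn (fun r : ℝ => H (r * (1 + σ))) (Ioi 0) := by
    intro σ hσ
    rw [integrableOn_Ioi_comp_mul_right_iff H 0 (by positivity)]
    simpa using hint
  -- The substitution `s = rσ` makes all powers of `r` cancel; after the swap, `v = r(1 + σ)`
  -- separates the variables.
  have e1 : ∀ r ∈ Ioi (0 : ℝ), r ^ (α - 1) • ∫ s in Ioi (0 : ℝ), s ^ (-α) • H (r + s) =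
      ∫ σ in Ioi (0 : ℝ), σ ^ (-α) • H (r * (1 + σ)) := by
    intro r hr
    have hr : 0 < r := hr
    have h := integral_comp_mul_left_Ioi (fun s : ℝ => s ^ (-α) • H (r + s)) 0 hr
    rw [mul_zero] at h
    have h' : ∫ s in Ioi (0 : ℝ), s ^ (-α) • H (r + s) =
        r • ∫ σ in Ioi (0 : ℝ), (r * σ) ^ (-α) • H (r + r * σ) := by
      rw [h, smul_inv_smul₀ hr.ne']
    rw [h', smul_smul, ← integral_smul]
    refine setIntegral_congr_fun measurableSet_Ioi fun σ (hσ : 0 < σ) => ?_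
    simp only [smul_smul]
    rw [Real.mul_rpow hr.le hσ.le, show r + r * σ = r * (1 + σ) by ring]
    congr 1
    have : r ^ (α - 1) * r * r ^ (-α) = 1 := by
      rw [← Real.rpow_add_one hr.ne', ← Real.rpow_add hr]; simp
    linear_combination σ ^ (-α) * this
  rw [setIntegral_congr_fun measurableSet_Ioi e1, integral_integral_swap]
  · rw [← integral_smul_const]
    refine setIntegral_congr_fun measurableSet_Ioi fun σ (hσ : 0 < σ) => ?_
    rw [integral_smul, integral_comp_mul_right_Ioi H 0 (by positivity), zero_mul, smul_smul]
  · have hm : AEStronglyMeasurable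
        (Function.uncurry fun r σ : ℝ => σ ^ (-α) • H (r * (1 + σ)))
        ((volume.restrict (Ioi (0 : ℝ))).prod (volume.restrict (Ioi (0 : ℝ)))) := by
      rw [Measure.prod_restrict]
      refine ContinuousOn.aestronglyMeasurable ?_ (measurableSet_Ioi.prod measurableSet_Ioi)
      refine ContinuousOn.smul ?_ ?_
      · exact continuousOn_snd.rpow_const fun x hx => Or.inl (ne_of_gt hx.2)
      · refine hH.comp (by fun_prop) fun x hx => ?_
        have a1 : 0 < x.1 := hx.1
        have a2 : 0 < x.2 := hx.2
        exact mul_pos a1 (by positivity)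
    rw [integrable_prod_iff' hm]
    constructor
    · filter_upwards [ae_restrict_mem measurableSet_Ioi] with σ (hσ : 0 < σ)
      exact (hint' σ hσ).smul (σ ^ (-α))
    · have e2 : ∀ σ ∈ Ioi (0 : ℝ), (σ ^ (-α) * (1 + σ)⁻¹) * ∫ v in Ioi (0 : ℝ), ‖H v‖ =
          ∫ r in Ioi (0 : ℝ), ‖σ ^ (-α) • H (r * (1 + σ))‖ := by
        intro σ hσ
        have hσ : 0 < σ := hσ
        simp_rw [norm_smul, Real.norm_of_nonneg (Real.rpow_nonneg hσ.le (-α))]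
        rw [integral_const_mul,
          integral_comp_mul_right_Ioi (fun v => ‖H v‖) 0 (by positivity : 0 < 1 + σ),
          zero_mul, smul_eq_mul, mul_assoc]
      exact IntegrableOn.congr_fun ((integrableOn_rpow_neg_mul_inv_one_add h0 h1).mul_const _)
        e2 measurableSet_Ioi

/-- The constant in the kernel composition does not depend on `H`, so it can be read off from `H(v)
= e^{-v}`, for which the double integral is a product of two Gamma integrals. -/
theorem integral_rpow_neg_mul_inv_one_add {α : ℝ} (h0 : 0 < α) (h1 : α < 1) :
    ∫ σ in Ioi (0 : ℝ), σ ^ (-α) * (1 + σ)⁻¹ = Real.Gamma α * Real.Gamma (1 - α) := by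
  have h := integral_rpow_smul_integral_rpow_smul_aux (H := fun v : ℝ => Real.exp (-v))
    (C := 1) (ω := 1) h0 h1 one_pos (by fun_prop) (by intro v _; simp)
  rw [integral_exp_neg_Ioi_zero, smul_eq_mul, mul_one] at h
  rw [← h]
  rw [Real.Gamma_eq_integral h0, ← integral_mul_const]
  refine setIntegral_congr_fun measurableSet_Ioi fun r _ => ?_
  simp only [smul_eq_mul]
  rw [Real.Gamma_eq_integral (by linarith), ← integral_const_mul, ← integral_const_mul]
  refine setIntegral_congr_fun measurableSet_Ioi fun s _ => ?_
  rw [neg_add, Real.exp_add, show 1 - α - 1 = -α by ring]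
  ring

/-- The composition rule of the Abel kernels of orders `α` and `1 - α`. -/
theorem integral_rpow_smul_integral_rpow_smul [CompleteSpace E] {H : ℝ → E} {α C ω : ℝ}
    (h0 : 0 < α) (h1 : α < 1) (hω : 0 < ω) (hH : ContinuousOn H (Ioi 0))
    (hb : ∀ v, 0 < v → ‖H v‖ ≤ C * Real.exp (-ω * v)) :
    ∫ r in Ioi (0 : ℝ), r ^ (α - 1) • ∫ s in Ioi (0 : ℝ), s ^ (-α) • H (r + s) =
      (Real.Gamma α * Real.Gamma (1 - α)) • ∫ v in Ioi (0 : ℝ), H v := by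
  rw [integral_rpow_smul_integral_rpow_smul_aux h0 h1 hω hH hb,
    integral_rpow_neg_mul_inv_one_add h0 h1]

/-- Scaling of the kernel `s ^ (-α) / (t + s)`. -/
theorem integral_rpow_neg_mul_inv_add {α t : ℝ} (h0 : 0 < α) (h1 : α < 1) (ht : 0 < t) :
    IntegrableOn (fun s : ℝ => s ^ (-α) * (t + s)⁻¹) (Ioi 0) ∧
    ∫ s in Ioi (0 : ℝ), s ^ (-α) * (t + s)⁻¹ =
      t ^ (-α) * (Real.Gamma α * Real.Gamma (1 - α)) := by
  have e : ∀ σ ∈ Ioi (0 : ℝ), (t * σ) ^ (-α) * (t + t * σ)⁻¹ =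
      t ^ (-α) * t⁻¹ * (σ ^ (-α) * (1 + σ)⁻¹) := by
    intro σ hσ
    have hσ : 0 < σ := hσ
    rw [Real.mul_rpow ht.le hσ.le, show t + t * σ = t * (1 + σ) by ring, mul_inv]
    ring
  constructor
  · have := (integrableOn_Ioi_comp_mul_left_iff (fun s : ℝ => s ^ (-α) * (t + s)⁻¹) 0 ht).1
      (IntegrableOn.congr_fun (((integrableOn_rpow_neg_mul_inv_one_add h0 h1).const_mul
        (t ^ (-α) * t⁻¹))) (fun σ hσ => (e σ hσ).symm) measurableSet_Ioi)
    simpa using this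
  · have h := integral_comp_mul_left_Ioi (fun s : ℝ => s ^ (-α) * (t + s)⁻¹) 0 ht
    rw [setIntegral_congr_fun measurableSet_Ioi e, integral_const_mul,
      integral_rpow_neg_mul_inv_one_add h0 h1, mul_zero, smul_eq_mul] at h
    rw [← mul_right_inj' (inv_ne_zero ht.ne'), ← h]
    ring

end Kernel

/-! ### Derivative bounds for analytic semigroups. -/

section AnalyticSemigroup

variable {X : Type*} [NormedAddCommGroup X] [NormedSpace ℂ X]

/-- A sector is invariant under positive scaling, so a ball around `1` suffices. A radius
proportional to `t` is what turns Cauchy's estimate into a bound of order `1/t`. -/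
theorem exists_closedBall_subset_sector {θ : ℝ} (hθ : 0 < θ) :
    ∃ κ : ℝ, 0 < κ ∧ κ < 1 ∧
      ∀ t : ℝ, 0 < t → Metric.closedBall (t : ℂ) (κ * t) ⊆ sector θ := by
  have h1 : ∀ᶠ z in 𝓝 (1 : ℂ), |z.arg| < θ := by
    have := (Complex.continuousAt_arg Complex.one_mem_slitPlane).abs
    refine this.eventually_lt_const ?_
    simpa using hθ
  have h2 : ∀ᶠ z in 𝓝 (1 : ℂ), z ≠ 0 := eventually_ne_nhds one_ne_zero
  obtain ⟨ε, hε, hb⟩ := Metric.eventually_nhds_iff.1 (h1.and h2)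
  refine ⟨min ε 1 / 2, by positivity, by linarith [min_le_right ε 1], fun t ht z hz => ?_⟩
  have htc : (t : ℂ) ≠ 0 := by exact_mod_cast ht.ne'
  obtain ⟨w, rfl⟩ : ∃ w : ℂ, z = t * w := ⟨z / t, by field_simp⟩
  rw [Metric.mem_closedBall, dist_eq_norm, show (t : ℂ) * w - t = t * (w - 1) by ring, norm_mul,
    Complex.norm_of_nonneg ht.le, mul_comm, mul_le_mul_iff_left₀ ht] at hz
  have hw : dist w 1 < ε := by
    rw [dist_eq_norm]
    have : 0 < min ε 1 := by positivity
    linarith [min_le_left ε 1]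
  obtain ⟨ha, h0⟩ := hb hw
  exact ⟨mul_ne_zero htc h0, by rwa [Complex.arg_real_mul _ ht]⟩

/-- Uniform boundedness: otherwise some sequence `z n → 0` in `s` has unbounded norms, although `S
(z n) x` converges for every `x`. -/
theorem exists_norm_le_of_tendsto_sector [CompleteSpace X] {S : ℂ → X →L[ℂ] X} {s : Set ℂ}
    (h : ∀ x, Tendsto (fun z => S z x) (𝓝[s] 0) (𝓝 x)) :
    ∃ δ M : ℝ, 0 < δ ∧ 0 < M ∧ ∀ z ∈ s, ‖z‖ < δ → ‖S z‖ ≤ M := by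
  by_contra! hcon
  choose z hzs hzn hz using fun n : ℕ => hcon (1 / ((n : ℝ) + 1)) (n + 1) (by positivity)
    (by positivity)
  have hz0 : Tendsto z atTop (𝓝[s] 0) := by
    refine tendsto_nhdsWithin_iff.2 ⟨?_, Eventually.of_forall hzs⟩
    exact squeeze_zero_norm (fun n => (hzn n).le) tendsto_one_div_add_atTop_nhds_zero_nat
  obtain ⟨C, hC⟩ := banach_steinhaus (g := fun n => S (z n)) fun x => by
    obtain ⟨C, hC⟩ := ((h x).comp hz0).norm.bddAbove_range
    exact ⟨C, fun n => hC ⟨n, rfl⟩⟩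
  obtain ⟨n, hn⟩ := exists_nat_gt C
  linarith [hC n, hz n]

namespace C0Semigroup

variable (T : C0Semigroup X)

theorem IsAnalytic.hasDerivAt_op {T : C0Semigroup X} (h : T.IsAnalytic) {t : ℝ} (ht : 0 < t) :
    HasDerivAt T.op (deriv T.op t) t := by
  obtain ⟨φ, hφ, -, S, hST, hS, -⟩ := h
  obtain ⟨κ, hκ, -, hb⟩ := exists_closedBall_subset_sector hφ
  have hd : DifferentiableAt ℂ S t :=
    hS.differentiableAt (mem_of_superset (Metric.closedBall_mem_nhds _ (by positivity)) (hb t ht))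
  have := hd.hasDerivAt.scomp t (Complex.ofRealCLM.hasDerivAt (x := t))
  have h2 : T.op =ᶠ[𝓝 t] S ∘ Complex.ofRealCLM := by
    filter_upwards [lt_mem_nhds ht] with s hs using (hST s hs).symm
  exact (this.congr_of_eventuallyEq h2).differentiableAt.hasDerivAt

theorem IsAnalytic.exists_norm_deriv_op_le [CompleteSpace X] {T : C0Semigroup X}
    (h : T.IsAnalytic) :
    ∃ δ C : ℝ, 0 < δ ∧ 0 < C ∧ ∀ t, 0 < t → t ≤ δ → ‖deriv T.op t‖ ≤ C * t⁻¹ := by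
  obtain ⟨φ, hφ, -, S, hST, hS, θ, hθ, hθφ, hlim⟩ := h
  obtain ⟨κ, hκ, hκ1, hb⟩ := exists_closedBall_subset_sector hθ
  obtain ⟨δ, M, hδ, hM, hbd⟩ := exists_norm_le_of_tendsto_sector hlim
  have hsub : sector θ ⊆ sector φ := fun z hz => ⟨hz.1, hz.2.trans hθφ⟩
  -- Points of the circle of radius `κ t` around `t` have norm below `2t`, since `κ < 1`; hence `δ /
  -- 2`.
  refine ⟨δ / 2, M / κ, by positivity, by positivity, fun t ht htδ => ?_⟩
  have hd : DifferentiableAt ℂ S t := hS.differentiableAt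
    (mem_of_superset (Metric.closedBall_mem_nhds _ (by positivity)) ((hb t ht).trans hsub))
  have h1 := hd.hasDerivAt.scomp t (Complex.ofRealCLM.hasDerivAt (x := t))
  have h2 : T.op =ᶠ[𝓝 t] S ∘ Complex.ofRealCLM := by
    filter_upwards [lt_mem_nhds ht] with s hs using (hST s hs).symm
  have h3 : deriv T.op t = deriv S t := by
    rw [(h1.congr_of_eventuallyEq h2).deriv]
    simp
  rw [h3]
  have h4 := Complex.norm_deriv_le_of_forall_mem_sphere_norm_le (C := M) (c := (t : ℂ)) (f := S)
    (mul_pos hκ ht) ((hS.mono hsub).diffContOnCl_ball (hb t ht)) fun z hz => by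
      have hz' := Metric.sphere_subset_closedBall hz
      refine hbd z (hb t ht hz') ?_
      rw [Metric.mem_closedBall, dist_eq_norm] at hz'
      have h5 : ‖z‖ ≤ ‖z - t‖ + ‖(t : ℂ)‖ := by simpa using norm_add_le (z - t) (t : ℂ)
      rw [Complex.norm_of_nonneg ht.le] at h5
      nlinarith
  refine h4.trans (le_of_eq ?_)
  rw [div_mul_eq_div_div, div_eq_mul_inv]

theorem continuousOn_op_of_isAnalytic {T : C0Semigroup X} (h : T.IsAnalytic) :
    ContinuousOn T.op (Ioi 0) :=
  fun _ ht => (h.hasDerivAt_op ht).continuousAt.continuousWithinAt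

theorem IsAnalytic.continuousOn_op_apply {T : C0Semigroup X} (h : T.IsAnalytic) (x : X) :
    ContinuousOn (fun t => T.op t x) (Ici 0) := by
  intro t ht
  rcases eq_or_lt_of_le (show (0 : ℝ) ≤ t from ht) with rfl | ht
  · have := T.strong_cont x
    rw [← continuousWithinAt_Ioi_iff_Ici]
    simpa [ContinuousWithinAt, T.op_zero] using this
  · exact ((h.hasDerivAt_op ht).continuousAt.clm_apply continuousAt_const).continuousWithinAt

variable {T}

theorem op_comm {s t : ℝ} (hs : 0 ≤ s) (ht : 0 ≤ t) :
    (T.op s).comp (T.op t) = (T.op t).comp (T.op s) := by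
  rw [← T.op_add s t hs ht, ← T.op_add t s ht hs, add_comm]

theorem IsAnalytic.hasDerivAt_clm {F : Type*} [NormedAddCommGroup F] [NormedSpace ℂ F]
    (h : T.IsAnalytic) (L : (X →L[ℂ] X) →L[ℂ] F) {t : ℝ} (ht : 0 < t) :
    HasDerivAt (fun s => L (T.op s)) (L (deriv T.op t)) t :=
  (L.restrictScalars ℝ).hasFDerivAt.comp_hasDerivAt t (h.hasDerivAt_op ht)

theorem IsAnalytic.comp_deriv_op_of_comm (h : T.IsAnalytic) {S : X →L[ℂ] X}
    (hS : ∀ t, 0 < t → S.comp (T.op t) = (T.op t).comp S) {t : ℝ} (ht : 0 < t) :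
    S.comp (deriv T.op t) = (deriv T.op t).comp S := by
  have h1 := h.hasDerivAt_clm (ContinuousLinearMap.compL ℂ X X X S) ht
  have h2 := h.hasDerivAt_clm ((ContinuousLinearMap.compL ℂ X X X).flip S) ht
  refine h1.unique (h2.congr_of_eventuallyEq ?_)
  filter_upwards [lt_mem_nhds ht] with s hs
  exact hS s hs

theorem IsAnalytic.op_comp_deriv_op (h : T.IsAnalytic) {r t : ℝ} (hr : 0 ≤ r) (ht : 0 < t) :
    (T.op r).comp (deriv T.op t) = deriv T.op (r + t) := by
  have h1 := h.hasDerivAt_clm (ContinuousLinearMap.compL ℂ X X X (T.op r)) ht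
  have h2 : HasDerivAt (fun s => T.op (r + s)) (deriv T.op (r + t)) t :=
    (h.hasDerivAt_op (by positivity)).comp_const_add r t
  refine h1.unique (h2.congr_of_eventuallyEq ?_)
  filter_upwards [lt_mem_nhds ht] with s hs
  exact (T.op_add r s hr hs.le).symm

/-- Near `t` one has `T'(s) = T(s - t/2) T'(t/2)`, so continuity is inherited from `T`. -/
theorem IsAnalytic.continuousOn_deriv_op (h : T.IsAnalytic) :
    ContinuousOn (deriv T.op) (Ioi 0) := by
  intro t (ht : 0 < t)
  have h1 : ContinuousAt (fun s => (T.op (s - t / 2)).comp (deriv T.op (t / 2))) t := by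
    have : ContinuousAt T.op (t - t / 2) := (h.hasDerivAt_op (by linarith)).continuousAt
    exact (ContinuousAt.comp (f := fun s => s - t / 2) this (by fun_prop)).clm_comp
      continuousAt_const
  refine (h1.congr ?_).continuousWithinAt
  filter_upwards [lt_mem_nhds (show t / 2 < t by linarith)] with s hs
  rw [h.op_comp_deriv_op (by linarith) (by linarith)]
  congr 1; ring

/-- Joint exponential bounds for an exponentially stable analytic semigroup and its derivative. -/
theorem exists_exp_bounds [CompleteSpace X] (h : T.IsAnalytic) (hst : T.IsExpStable) :
    ∃ C ω : ℝ, 0 < C ∧ 0 < ω ∧ (∀ t, 0 ≤ t → ‖T.op t‖ ≤ C * Real.exp (-ω * t)) ∧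
      ∀ t, 0 < t → ‖deriv T.op t‖ ≤ C * (t⁻¹ * Real.exp (-ω * t)) := by
  obtain ⟨M, w, hM, hw, hMw⟩ := hst
  obtain ⟨δ, C, hδ, hC, hb⟩ := h.exists_norm_deriv_op_le
  set K := C * Real.exp (w / 2 * δ) with hK
  set K' := M * Real.exp (w * δ) * (C * δ⁻¹) * (2 / w) with hK'
  have hKpos : 0 < K := by positivity
  have hKpos' : 0 < K' := by positivity
  -- Half of the decay rate is given up: for `t ≥ δ`, the factor `e^{-wt/2}` pays for the missing
  -- `t⁻¹` through `t e^{-wt/2} ≤ 2/w`.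
  refine ⟨M + K + K', w / 2, by positivity, by positivity, fun t ht => ?_, fun t ht => ?_⟩
  · refine (hMw t ht).trans ?_
    have : Real.exp (-w * t) ≤ Real.exp (-(w / 2) * t) := Real.exp_le_exp.2 (by nlinarith)
    exact mul_le_mul (by linarith) this (Real.exp_pos _).le (by positivity)
  · have hpos : 0 < t⁻¹ * Real.exp (-(w / 2) * t) := by positivity
    rcases le_total t δ with htδ | htδ
    · have h1 : ‖deriv T.op t‖ ≤ K * (t⁻¹ * Real.exp (-(w / 2) * t)) := by
        refine (hb t ht htδ).trans ?_
        have : 1 ≤ Real.exp (w / 2 * δ) * Real.exp (-(w / 2) * t) := by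
          rw [← Real.exp_add]; exact Real.one_le_exp (by nlinarith)
        have h3 : 0 < C * t⁻¹ := by positivity
        calc C * t⁻¹ ≤ C * t⁻¹ * (Real.exp (w / 2 * δ) * Real.exp (-(w / 2) * t)) :=
              le_mul_of_one_le_right h3.le this
          _ = _ := by rw [hK]; ring
      refine h1.trans (mul_le_mul_of_nonneg_right (by linarith) hpos.le)
    · have h1 : ‖deriv T.op t‖ ≤ K' * (t⁻¹ * Real.exp (-(w / 2) * t)) := by
        have e : deriv T.op t = (T.op (t - δ)).comp (deriv T.op δ) := by
          rw [h.op_comp_deriv_op (by linarith) hδ]; congr 1; ring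
        rw [e]
        refine (ContinuousLinearMap.opNorm_comp_le _ _).trans ?_
        refine (mul_le_mul (hMw (t - δ) (by linarith)) (hb δ hδ le_rfl) (norm_nonneg _)
          (by positivity)).trans ?_
        have h5 : t * Real.exp (-(w / 2) * t) ≤ 2 / w := by
          have := Real.add_one_le_exp (w / 2 * t)
          rw [neg_mul, Real.exp_neg, ← div_eq_mul_inv, div_le_div_iff₀ (Real.exp_pos _) hw]
          nlinarith
        have h6 : Real.exp (-w * (t - δ)) = Real.exp (w * δ) *
            (t * Real.exp (-(w / 2) * t)) * (t⁻¹ * Real.exp (-(w / 2) * t)) := by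
          rw [show -w * (t - δ) = w * δ + (-(w / 2) * t + -(w / 2) * t) by ring, Real.exp_add,
            Real.exp_add]
          field_simp
        rw [h6, hK']
        have h7 : 0 ≤ M * Real.exp (w * δ) * (C * δ⁻¹) * (t⁻¹ * Real.exp (-(w / 2) * t)) := by
          positivity
        have := mul_le_mul_of_nonneg_left h5 h7
        linarith
      refine h1.trans (mul_le_mul_of_nonneg_right (by linarith) hpos.le)

end C0Semigroup

end AnalyticSemigroup

/-! ### Fractional powers composed with the semigroup. -/

section FractionalPowers

variable {X : Type*} [NormedAddCommGroup X] [NormedSpace ℂ X]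

namespace C0Semigroup

/-- The operator `(-A)^α T(t)`, for `0 ≤ α < 1` and `t > 0`. -/
noncomputable def fracOp (T : C0Semigroup X) (α t : ℝ) : X →L[ℂ] X :=
  if α = 0 then T.op t
  else -((Real.Gamma (1 - α))⁻¹ • ∫ s in Ioi (0 : ℝ), s ^ (-α) • deriv T.op (t + s))

variable {T : C0Semigroup X}

theorem norm_rpow_smul_deriv_op_le {α C ω t : ℝ} (hω : 0 < ω)
    (hb : ∀ t, 0 < t → ‖deriv T.op t‖ ≤ C * (t⁻¹ * Real.exp (-ω * t))) (hC : 0 < C)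
    (ht : 0 < t) {s : ℝ} (hs : 0 < s) :
    ‖s ^ (-α) • deriv T.op (t + s)‖ ≤
      C * Real.exp (-ω * t) * (s ^ (-α) * (t + s)⁻¹) := by
  have h1 : 0 ≤ s ^ (-α) := Real.rpow_nonneg hs.le _
  rw [norm_smul, Real.norm_of_nonneg h1]
  have h2 := hb (t + s) (by positivity)
  have h3 : Real.exp (-ω * (t + s)) ≤ Real.exp (-ω * t) := Real.exp_le_exp.2 (by nlinarith)
  have h4 : ‖deriv T.op (t + s)‖ ≤ C * ((t + s)⁻¹ * Real.exp (-ω * t)) :=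
    h2.trans (by gcongr)
  have := mul_le_mul_of_nonneg_left h4 h1
  linarith

theorem tendsto_op_atTop (hst : T.IsExpStable) : Tendsto T.op atTop (𝓝 0) := by
  obtain ⟨M, w, -, hw, hb⟩ := hst
  refine squeeze_zero_norm' (a := fun t => M * Real.exp (-w * t)) ?_ ?_
  · filter_upwards [eventually_ge_atTop 0] with t ht using hb t ht
  · have : Tendsto (fun t : ℝ => -w * t) atTop atBot :=
      tendsto_id.const_mul_atTop_of_neg (by linarith)
    simpa using (Real.tendsto_exp_atBot.comp this).const_mul M

theorem eq_zero_of_frequently_op_eq_zero {x : X} (hx : ∃ᶠ t in 𝓝[>] (0 : ℝ), T.op t x = 0) :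
    x = 0 := by
  by_contra hne
  exact hx ((T.strong_cont x).eventually_ne hne)

variable [CompleteSpace X]

theorem integrableOn_rpow_smul_op (h : T.IsAnalytic) (hst : T.IsExpStable) {α : ℝ} (hα : 0 < α) :
    IntegrableOn (fun t : ℝ => t ^ (α - 1) • T.op t) (Ioi 0) := by
  obtain ⟨C, ω, hC, hω, hb, -⟩ := exists_exp_bounds h hst
  have hi := (integrableOn_rpow_neg_mul_exp (α := 1 - α) (by linarith) hω).const_mul C
  refine Integrable.mono' hi (ContinuousOn.aestronglyMeasurable
    (ContinuousOn.smul (continuousOn_id.rpow_const fun x hx => Or.inl (ne_of_gt hx))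
      (continuousOn_op_of_isAnalytic h)) measurableSet_Ioi) ?_
  filter_upwards [ae_restrict_mem measurableSet_Ioi] with t (ht : 0 < t)
  have h1 : 0 ≤ t ^ (α - 1) := Real.rpow_nonneg ht.le _
  rw [norm_smul, Real.norm_of_nonneg h1, neg_sub]
  have := mul_le_mul_of_nonneg_left (hb t ht.le) h1
  linarith

theorem integrableOn_rpow_smul_deriv_op (h : T.IsAnalytic) (hst : T.IsExpStable) {α t : ℝ}
    (h0 : 0 < α) (h1 : α < 1) (ht : 0 < t) :
    IntegrableOn (fun s : ℝ => s ^ (-α) • deriv T.op (t + s)) (Ioi 0) := by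
  obtain ⟨C, ω, hC, hω, -, hb⟩ := exists_exp_bounds h hst
  have hi := (integral_rpow_neg_mul_inv_add h0 h1 ht).1.const_mul (C * Real.exp (-ω * t))
  refine Integrable.mono' hi (ContinuousOn.aestronglyMeasurable
    (ContinuousOn.smul (continuousOn_id.rpow_const fun x hx => Or.inl (ne_of_gt hx))
      (h.continuousOn_deriv_op.comp (by fun_prop) fun s (hs : 0 < s) => add_pos ht hs))
    measurableSet_Ioi) ?_
  filter_upwards [ae_restrict_mem measurableSet_Ioi] with s (hs : 0 < s)
  exact norm_rpow_smul_deriv_op_le hω hb hC ht hs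

/-- The rate `ω` is chosen before `α`, so that the bounds for the exponents `p` and `q` can later be
combined with a single exponential. -/
theorem exists_norm_fracOp_le (h : T.IsAnalytic) (hst : T.IsExpStable) :
    ∃ ω : ℝ, 0 < ω ∧ ∀ α : ℝ, 0 ≤ α → α < 1 → ∃ K : ℝ, 0 < K ∧
      ∀ t, 0 < t → ‖T.fracOp α t‖ ≤ K * (t ^ (-α) * Real.exp (-ω * t)) := by
  obtain ⟨C, ω, hC, hω, hb0, hb⟩ := exists_exp_bounds h hst
  refine ⟨ω, hω, fun α hα h1 => ?_⟩
  -- The exponent `0` is separate: the majorant `s^{-α} (t+s)⁻¹` is not integrable at infinity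
  -- there.
  rcases hα.eq_or_lt with rfl | h0
  · refine ⟨C, hC, fun t ht => ?_⟩
    simpa [fracOp] using hb0 t ht.le
  · have g1 := Real.Gamma_pos_of_pos h0
    have g2 := Real.Gamma_pos_of_pos (sub_pos.2 h1)
    refine ⟨C * Real.Gamma α, by positivity, fun t ht => ?_⟩
    obtain ⟨hi, he⟩ := integral_rpow_neg_mul_inv_add h0 h1 ht
    rw [fracOp, if_neg h0.ne', norm_neg, norm_smul, Real.norm_of_nonneg (inv_nonneg.2 g2.le)]
    have h3 : ‖∫ s in Ioi (0 : ℝ), s ^ (-α) • deriv T.op (t + s)‖ ≤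
        C * Real.exp (-ω * t) * (t ^ (-α) * (Real.Gamma α * Real.Gamma (1 - α))) := by
      rw [← he, ← integral_const_mul]
      refine norm_integral_le_of_norm_le (hi.const_mul _) ?_
      filter_upwards [ae_restrict_mem measurableSet_Ioi] with s (hs : 0 < s)
      exact norm_rpow_smul_deriv_op_le hω hb hC ht hs
    refine (mul_le_mul_of_nonneg_left h3 (inv_nonneg.2 g2.le)).trans (le_of_eq ?_)
    field_simp

theorem comp_fracOp_of_comm (h : T.IsAnalytic) (hst : T.IsExpStable) {S : X →L[ℂ] X}
    (hS : ∀ t, 0 < t → S.comp (T.op t) = (T.op t).comp S) {α t : ℝ} (h0 : 0 ≤ α) (h1 : α < 1)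
    (ht : 0 < t) : S.comp (T.fracOp α t) = (T.fracOp α t).comp S := by
  rcases h0.eq_or_lt with rfl | h0
  · simpa [fracOp] using hS t ht
  · have hi := integrableOn_rpow_smul_deriv_op h hst h0 h1 ht
    have e1 := (ContinuousLinearMap.compL ℂ X X X S).integral_comp_comm hi
    have e2 := ((ContinuousLinearMap.compL ℂ X X X).flip S).integral_comp_comm hi
    simp only [ContinuousLinearMap.compL_apply, ContinuousLinearMap.flip_apply] at e1 e2
    rw [fracOp, if_neg h0.ne', ContinuousLinearMap.comp_neg, ContinuousLinearMap.neg_comp,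
      ContinuousLinearMap.comp_smul, ContinuousLinearMap.smul_comp, ← e1, ← e2]
    congr 2
    refine setIntegral_congr_fun measurableSet_Ioi fun s (hs : 0 < s) => ?_
    rw [ContinuousLinearMap.comp_smul, ContinuousLinearMap.smul_comp,
      h.comp_deriv_op_of_comm hS (add_pos ht hs)]

theorem op_comp_fracOp (h : T.IsAnalytic) (hst : T.IsExpStable) {α r t : ℝ} (h0 : 0 ≤ α)
    (h1 : α < 1) (hr : 0 ≤ r) (ht : 0 < t) :
    (T.op r).comp (T.fracOp α t) = T.fracOp α (r + t) := by
  rcases h0.eq_or_lt with rfl | h0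
  · simpa [fracOp] using (T.op_add r t hr ht.le).symm
  · have hi := integrableOn_rpow_smul_deriv_op h hst h0 h1 ht
    have e1 := (ContinuousLinearMap.compL ℂ X X X (T.op r)).integral_comp_comm hi
    simp only [ContinuousLinearMap.compL_apply] at e1
    rw [fracOp, fracOp, if_neg h0.ne', if_neg h0.ne', ContinuousLinearMap.comp_neg,
      ContinuousLinearMap.comp_smul, ← e1]
    congr 2
    refine setIntegral_congr_fun measurableSet_Ioi fun s (hs : 0 < s) => ?_
    rw [ContinuousLinearMap.comp_smul, h.op_comp_deriv_op hr (add_pos ht hs), add_assoc]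

theorem fracOp_comp_op (h : T.IsAnalytic) (hst : T.IsExpStable) {α r t : ℝ} (h0 : 0 ≤ α)
    (h1 : α < 1) (hr : 0 ≤ r) (ht : 0 < t) :
    (T.fracOp α t).comp (T.op r) = T.fracOp α (r + t) := by
  rw [← op_comp_fracOp h hst h0 h1 hr ht,
    comp_fracOp_of_comm h hst (fun s hs => op_comm hr hs.le) h0 h1 ht]

theorem continuousOn_fracOp (h : T.IsAnalytic) (hst : T.IsExpStable) {α : ℝ} (h0 : 0 ≤ α)
    (h1 : α < 1) : ContinuousOn (T.fracOp α) (Ioi 0) := by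
  intro t (ht : 0 < t)
  have h2 : ContinuousAt (fun s => (T.op (s - t / 2)).comp (T.fracOp α (t / 2))) t := by
    have : ContinuousAt T.op (t - t / 2) := (h.hasDerivAt_op (by linarith)).continuousAt
    exact (ContinuousAt.comp (f := fun s => s - t / 2) this (by fun_prop)).clm_comp
      continuousAt_const
  refine (h2.congr ?_).continuousWithinAt
  filter_upwards [lt_mem_nhds (show t / 2 < t by linarith)] with s hs
  rw [op_comp_fracOp h hst h0 h1 (by linarith) (by linarith)]
  congr 1; ring

theorem comp_negPow_of_comm (h : T.IsAnalytic) (hst : T.IsExpStable) {S : X →L[ℂ] X}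
    (hS : ∀ t, 0 < t → S.comp (T.op t) = (T.op t).comp S) {α : ℝ} (h0 : 0 ≤ α) :
    S.comp (T.negPow α) = (T.negPow α).comp S := by
  rcases h0.eq_or_lt with rfl | h0
  · simp [negPow]
  · have hi := integrableOn_rpow_smul_op h hst h0
    have e1 := (ContinuousLinearMap.compL ℂ X X X S).integral_comp_comm hi
    have e2 := ((ContinuousLinearMap.compL ℂ X X X).flip S).integral_comp_comm hi
    simp only [ContinuousLinearMap.compL_apply, ContinuousLinearMap.flip_apply] at e1 e2
    rw [negPow, if_neg h0.ne', ContinuousLinearMap.comp_smul, ContinuousLinearMap.smul_comp,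
      ← e1, ← e2]
    congr 1
    refine setIntegral_congr_fun measurableSet_Ioi fun s (hs : 0 < s) => ?_
    rw [ContinuousLinearMap.comp_smul, ContinuousLinearMap.smul_comp, hS s hs]

/-- Inserting both integrals leaves a double integral of `r^{α-1} s^{-α} T'(t+r+s)`. The kernel
composition collapses it to `Γ(α) Γ(1-α) ∫ T'(t+v) dv`, and that integral is `-T(t)` because `T`
decays at infinity. -/
theorem negPow_comp_fracOp (h : T.IsAnalytic) (hst : T.IsExpStable) {α t : ℝ} (h0 : 0 ≤ α)
    (h1 : α < 1) (ht : 0 < t) : (T.negPow α).comp (T.fracOp α t) = T.op t := by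
  rcases h0.eq_or_lt with rfl | h0
  · simp [negPow, fracOp]
  obtain ⟨C, ω, hC, hω, -, hb⟩ := exists_exp_bounds h hst
  have g1 := Real.Gamma_pos_of_pos h0
  have g2 := Real.Gamma_pos_of_pos (sub_pos.2 h1)
  have hcont : ContinuousOn (fun v => deriv T.op (t + v)) (Ioi 0) :=
    h.continuousOn_deriv_op.comp (by fun_prop) fun s (hs : 0 < s) => add_pos ht hs
  have hbd : ∀ v, 0 < v → ‖deriv T.op (t + v)‖ ≤ C * t⁻¹ * Real.exp (-ω * v) := by
    intro v hv
    refine (hb (t + v) (by positivity)).trans ?_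
    rw [mul_assoc]
    have a1 : (t + v)⁻¹ ≤ t⁻¹ := inv_anti₀ ht (by linarith)
    have a2 : Real.exp (-ω * (t + v)) ≤ Real.exp (-ω * v) := Real.exp_le_exp.2 (by nlinarith)
    gcongr
  have hK := integral_rpow_smul_integral_rpow_smul h0 h1 hω hcont hbd
  have hFTC : ∫ v in Ioi (0 : ℝ), deriv T.op (t + v) = -T.op t := by
    have hderiv : ∀ v : ℝ, 0 ≤ v → HasDerivAt (fun v => T.op (t + v)) (deriv T.op (t + v)) v :=
      fun v hv => (h.hasDerivAt_op (by positivity)).comp_const_add t v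
    have hint : IntegrableOn (fun v => deriv T.op (t + v)) (Ioi 0) := by
      refine Integrable.mono' ((exp_neg_integrableOn_Ioi 0 hω).const_mul (C * t⁻¹))
        (hcont.aestronglyMeasurable measurableSet_Ioi) ?_
      filter_upwards [ae_restrict_mem measurableSet_Ioi] with v hv using hbd v hv
    have := integral_Ioi_of_hasDerivAt_of_tendsto
      (hderiv 0 le_rfl).continuousAt.continuousWithinAt
      (fun v (hv : 0 < v) => hderiv v hv.le) hint
      ((tendsto_op_atTop hst).comp (tendsto_atTop_add_const_left _ t tendsto_id))
    simpa using this
  rw [hFTC] at hK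
  have hi := integrableOn_rpow_smul_op h hst h0
  have e2 := ((ContinuousLinearMap.compL ℂ X X X).flip (T.fracOp α t)).integral_comp_comm hi
  simp only [ContinuousLinearMap.compL_apply, ContinuousLinearMap.flip_apply] at e2
  rw [negPow, if_neg h0.ne', ContinuousLinearMap.smul_comp, ← e2]
  have e3 : ∀ r ∈ Ioi (0 : ℝ), (r ^ (α - 1) • T.op r).comp (T.fracOp α t) =
      -(Real.Gamma (1 - α))⁻¹ •
        (r ^ (α - 1) • ∫ s in Ioi (0 : ℝ), s ^ (-α) • deriv T.op (t + (r + s))) := by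
    intro r hr
    have hr : 0 < r := hr
    rw [ContinuousLinearMap.smul_comp, op_comp_fracOp h hst h0.le h1 hr.le ht, fracOp,
      if_neg h0.ne', smul_neg, neg_smul, smul_comm]
    simp_rw [show ∀ s : ℝ, r + t + s = t + (r + s) from fun s => by ring]
  rw [setIntegral_congr_fun measurableSet_Ioi e3, integral_smul, hK]
  rw [smul_neg, smul_neg, smul_neg, smul_smul, smul_smul,
    show (Real.Gamma α)⁻¹ * -(Real.Gamma (1 - α))⁻¹ * (Real.Gamma α * Real.Gamma (1 - α)) = -1
      by field_simp, neg_one_smul, neg_neg]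

theorem op_comm_negPow (h : T.IsAnalytic) (hst : T.IsExpStable) {α r : ℝ} (h0 : 0 ≤ α)
    (hr : 0 ≤ r) : (T.op r).comp (T.negPow α) = (T.negPow α).comp (T.op r) :=
  comp_negPow_of_comm h hst (fun _ hs => op_comm hr hs.le) h0

theorem fracOp_comp_negPow (h : T.IsAnalytic) (hst : T.IsExpStable) {α t : ℝ} (h0 : 0 ≤ α)
    (h1 : α < 1) (ht : 0 < t) : (T.fracOp α t).comp (T.negPow α) = T.op t := by
  rw [← negPow_comp_fracOp h hst h0 h1 ht]
  exact (comp_fracOp_of_comm h hst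
    (fun s hs => (op_comm_negPow h hst h0 hs.le).symm) h0 h1 ht).symm

/-- By `fracOp_comp_negPow`, a vector killed by `(-A)^{-α}` is killed by every `T(t)` with `t > 0`,
hence is zero by strong continuity. -/
theorem negPow_injective (h : T.IsAnalytic) (hst : T.IsExpStable) {α : ℝ} (h0 : 0 ≤ α)
    (h1 : α < 1) : Function.Injective (T.negPow α) := by
  refine (injective_iff_map_eq_zero _).2 fun x hx => eq_zero_of_frequently_op_eq_zero (T := T) ?_
  refine Eventually.frequently ?_
  filter_upwards [self_mem_nhdsWithin] with t (ht : 0 < t)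
  rw [← fracOp_comp_negPow h hst h0 h1 ht, ContinuousLinearMap.comp_apply, hx, map_zero]

theorem op_mem_posPow_domain (h : T.IsAnalytic) (hst : T.IsExpStable) {α t : ℝ} (h0 : 0 ≤ α)
    (h1 : α < 1) (ht : 0 < t) (x : X) :
    T.op t x ∈ (T.posPow α).domain ∧ T.posPowApply α (T.op t x) = T.fracOp α t x := by
  have hker : ((T.negPow α : X →ₗ[ℂ] X).toPMap ⊤).toFun.ker = ⊥ := by
    rw [LinearMap.ker_eq_bot]
    intro y z hyz
    exact Subtype.ext (negPow_injective h hst h0 h1 hyz)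
  -- This exhibits `T(t)x` in the range of `(-A)^{-α}` together with its preimage, which gives both
  -- claims.
  have hval : T.negPow α (T.fracOp α t x) = T.op t x := by
    rw [← ContinuousLinearMap.comp_apply, negPow_comp_fracOp h hst h0 h1 ht]
  have hmem : T.op t x ∈ (T.posPow α).domain := by
    rw [posPow, LinearPMap.inverse_domain]
    exact ⟨⟨T.fracOp α t x, trivial⟩, hval⟩
  refine ⟨hmem, ?_⟩
  rw [posPowApply, dif_pos hmem]
  exact LinearPMap.inverse_apply_eq hker (x := ⟨T.fracOp α t x, trivial⟩) hval

end C0Semigroup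

end FractionalPowers

/-! ### The function `W_q` as a squared operator norm. -/

section LyapunovFunction

theorem norm_toLp_two_sq {Ω E : Type*} [MeasurableSpace Ω] {μ : Measure Ω}
    [NormedAddCommGroup E] {f : Ω → E} (hf : MemLp f 2 μ) :
    ‖hf.toLp f‖ ^ 2 = ∫ t, ‖f t‖ ^ 2 ∂μ := by
  have h0 : 0 ≤ ∫ t, ‖f t‖ ^ 2 ∂μ := integral_nonneg fun t => by positivity
  rw [Lp.norm_toLp, hf.eLpNorm_eq_integral_rpow_norm two_ne_zero ENNReal.ofNat_ne_top]
  simp only [ENNReal.toReal_ofNat, Real.rpow_two]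
  rw [ENNReal.toReal_ofReal (Real.rpow_nonneg h0 _), ← Real.rpow_natCast, ← Real.rpow_mul h0]
  norm_num

namespace C0Semigroup

variable {X : Type*} [NormedAddCommGroup X] [NormedSpace ℂ X] [CompleteSpace X]
  {T : C0Semigroup X}

theorem lyapW_eq (h : T.IsAnalytic) (hst : T.IsExpStable) {q : ℝ} (h0 : 0 ≤ q) (h1 : q < 1)
    (x : X) : lyapW T q x = ∫ t in Ioi (0 : ℝ), ‖T.fracOp q t x‖ ^ 2 :=
  setIntegral_congr_fun measurableSet_Ioi fun t ht => by
    simp only [(op_mem_posPow_domain h hst h0 h1 ht x).2]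

theorem continuousOn_fracOp_apply (h : T.IsAnalytic) (hst : T.IsExpStable) {q : ℝ}
    (h0 : 0 ≤ q) (h1 : q < 1) (x : X) : ContinuousOn (fun t => T.fracOp q t x) (Ioi 0) :=
  (continuousOn_fracOp h hst h0 h1).clm_apply continuousOn_const

theorem exists_integral_norm_fracOp_sq_le (h : T.IsAnalytic) (hst : T.IsExpStable) {q : ℝ}
    (h0 : 0 ≤ q) (h1 : 2 * q < 1) :
    ∃ K : ℝ, 0 < K ∧ ∀ x : X, IntegrableOn (fun t => ‖T.fracOp q t x‖ ^ 2) (Ioi 0) ∧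
      ∫ t in Ioi (0 : ℝ), ‖T.fracOp q t x‖ ^ 2 ≤ (K * ‖x‖) ^ 2 := by
  obtain ⟨ω, hω, hb⟩ := exists_norm_fracOp_le h hst
  obtain ⟨K, hK, hb⟩ := hb q h0 (by linarith)
  have hi := integrableOn_rpow_neg_mul_exp (α := 2 * q) h1 (ω := 2 * ω) (by positivity)
  have hpt : ∀ x : X, ∀ t : ℝ, 0 < t → ‖T.fracOp q t x‖ ^ 2 ≤
      K ^ 2 * ‖x‖ ^ 2 * (t ^ (-(2 * q)) * Real.exp (-(2 * ω) * t)) := by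
    intro x t ht
    have h2 : ‖T.fracOp q t x‖ ≤ K * (t ^ (-q) * Real.exp (-ω * t)) * ‖x‖ :=
      (ContinuousLinearMap.le_opNorm _ _).trans
        (mul_le_mul_of_nonneg_right (hb t ht) (norm_nonneg _))
    have h3 := pow_le_pow_left₀ (norm_nonneg _) h2 2
    refine h3.trans (le_of_eq ?_)
    have e1 : t ^ (-(2 * q)) = (t ^ (-q)) ^ 2 := by
      rw [← Real.rpow_natCast, ← Real.rpow_mul ht.le]; congr 1; push_cast; ring
    have e2 : Real.exp (-(2 * ω) * t) = Real.exp (-ω * t) ^ 2 := by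
      rw [← Real.exp_nat_mul]; congr 1; push_cast; ring
    rw [e1, e2]
    ring
  set I := ∫ t in Ioi (0 : ℝ), t ^ (-(2 * q)) * Real.exp (-(2 * ω) * t) with hI
  have hI0 : 0 ≤ I := setIntegral_nonneg measurableSet_Ioi fun t (ht : 0 < t) =>
    mul_nonneg (Real.rpow_nonneg ht.le _) (Real.exp_pos _).le
  -- The summand `1` only serves to make the constant visibly positive.
  refine ⟨K * (Real.sqrt I + 1), by positivity, fun x => ?_⟩
  have hint : IntegrableOn (fun t => ‖T.fracOp q t x‖ ^ 2) (Ioi 0) := by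
    refine Integrable.mono' (hi.const_mul (K ^ 2 * ‖x‖ ^ 2))
      (((continuousOn_fracOp_apply h hst h0 (by linarith) x).norm.pow 2).aestronglyMeasurable
        measurableSet_Ioi) ?_
    filter_upwards [ae_restrict_mem measurableSet_Ioi] with t ht
    rw [Real.norm_of_nonneg (by positivity)]
    exact hpt x t ht
  refine ⟨hint, ?_⟩
  calc ∫ t in Ioi (0 : ℝ), ‖T.fracOp q t x‖ ^ 2
      ≤ ∫ t in Ioi (0 : ℝ), K ^ 2 * ‖x‖ ^ 2 * (t ^ (-(2 * q)) * Real.exp (-(2 * ω) * t)) :=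
        setIntegral_mono_on hint (hi.const_mul _) measurableSet_Ioi fun t ht => hpt x t ht
    _ = K ^ 2 * ‖x‖ ^ 2 * Real.sqrt I ^ 2 := by rw [integral_const_mul, Real.sq_sqrt hI0]
    _ ≤ K ^ 2 * ‖x‖ ^ 2 * (Real.sqrt I + 1) ^ 2 := by
        gcongr
        linarith
    _ = _ := by ring

/-- The map `x ↦ (-A)^q T(·) x` as a bounded operator into `L²(0, ∞; X)`. -/
theorem exists_lyapOp (h : T.IsAnalytic) (hst : T.IsExpStable) {q : ℝ}
    (h0 : 0 ≤ q) (h1 : 2 * q < 1) :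
    ∃ F : X →L[ℂ] Lp X 2 (volume.restrict (Ioi (0 : ℝ))),
      (∀ x : X, (F x : ℝ → X) =ᵐ[volume.restrict (Ioi (0 : ℝ))] fun t => T.fracOp q t x) ∧
      ∀ x : X, lyapW T q x = ‖F x‖ ^ 2 := by
  have hq : q < 1 := by linarith
  obtain ⟨K, hK, hb⟩ := exists_integral_norm_fracOp_sq_le h hst h0 h1
  have hm : ∀ x : X, MemLp (fun t => T.fracOp q t x) 2 (volume.restrict (Ioi (0 : ℝ))) :=
    fun x => (memLp_two_iff_integrable_sq_norm
      ((continuousOn_fracOp_apply h hst h0 hq x).aestronglyMeasurable measurableSet_Ioi)).2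
      (hb x).1
  let F₀ : X →ₗ[ℂ] Lp X 2 (volume.restrict (Ioi (0 : ℝ))) :=
    { toFun := fun x => (hm x).toLp _
      map_add' := fun x y => by
        rw [← MemLp.toLp_add]
        exact MemLp.toLp_congr _ _ (Eventually.of_forall fun t => by simp)
      map_smul' := fun c x => by
        rw [RingHom.id_apply, ← MemLp.toLp_const_smul]
        exact MemLp.toLp_congr _ _ (Eventually.of_forall fun t => by simp) }
  have hn : ∀ x, ‖F₀ x‖ ^ 2 = ∫ t in Ioi (0 : ℝ), ‖T.fracOp q t x‖ ^ 2 :=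
    fun x => norm_toLp_two_sq (hm x)
  refine ⟨F₀.mkContinuous K fun x => ?_, fun x => (hm x).coeFn_toLp, fun x => ?_⟩
  · refine le_of_sq_le_sq ?_ (by positivity)
    rw [hn]
    exact (hb x).2
  · rw [lyapW_eq h hst h0 hq]
    exact (hn x).symm

/-- Every interval `(0, ε)` has positive measure, so it contains a time at which `(-A)^q T(t)x`
vanishes; applying `(-A)^{-q}` gives `T(t)x = 0` there. -/
theorem eq_zero_of_fracOp_ae_eq_zero (h : T.IsAnalytic) (hst : T.IsExpStable) {q : ℝ}
    (h0 : 0 ≤ q) (h1 : q < 1) {x : X}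
    (hx : ∀ᵐ t ∂volume.restrict (Ioi (0 : ℝ)), T.fracOp q t x = 0) : x = 0 := by
  refine eq_zero_of_frequently_op_eq_zero (T := T) fun hev => ?_
  obtain ⟨ε, hε, hev⟩ := mem_nhdsGT_iff_exists_Ioo_subset.1 hev
  have hε : 0 < ε := hε
  have h2 : ∀ᵐ t ∂volume.restrict (Ioo (0 : ℝ) ε), T.fracOp q t x = 0 :=
    ae_restrict_of_ae_restrict_of_subset Ioo_subset_Ioi_self hx
  have hne : NeBot (ae (volume.restrict (Ioo (0 : ℝ) ε))) := by
    rw [ae_neBot, Ne, Measure.restrict_eq_zero, Real.volume_Ioo]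
    simp [hε]
  obtain ⟨t, ht, hmem⟩ := (h2.and (ae_restrict_mem measurableSet_Ioo)).exists
  refine hev hmem ?_
  simp only [← negPow_comp_fracOp h hst h0 h1 hmem.1, ContinuousLinearMap.comp_apply, ht, map_zero]

theorem lyapOp_injective (h : T.IsAnalytic) (hst : T.IsExpStable) {q : ℝ}
    (h0 : 0 ≤ q) (h1 : q < 1) {F : X →L[ℂ] Lp X 2 (volume.restrict (Ioi (0 : ℝ)))}
    (hF : ∀ x : X, (F x : ℝ → X) =ᵐ[volume.restrict (Ioi (0 : ℝ))] fun t => T.fracOp q t x) :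
    Function.Injective F := by
  refine (injective_iff_map_eq_zero _).2 fun x hx => ?_
  refine eq_zero_of_fracOp_ae_eq_zero h hst h0 h1 ?_
  have h3 := hF x
  rw [hx] at h3
  filter_upwards [h3, Lp.coeFn_zero X 2 (volume.restrict (Ioi (0 : ℝ)))] with t e1 e2
  rw [← e1, e2, Pi.zero_apply]

end C0Semigroup

/-- On a Hilbert space, a quadratic form `‖F x‖²` with values in another Hilbert space is given by an
operator on the space itself. -/
theorem exists_norm_sq_eq_of_innerProductSpaceable {X Y : Type*} [NormedAddCommGroup X]
    [NormedSpace ℂ X] [CompleteSpace X] [NormedAddCommGroup Y] [NormedSpace ℂ Y]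
    [CompleteSpace Y] (hX : InnerProductSpaceable X) (hY : InnerProductSpaceable Y)
    (F : X →L[ℂ] Y) (hF : Function.Injective F) :
    ∃ G : X →L[ℂ] X, Function.Injective G ∧ ∀ x, ‖F x‖ ^ 2 = ‖G x‖ ^ 2 := by
  let _ : InnerProductSpace ℂ X := InnerProductSpace.ofNorm ℂ hX.parallelogram_identity
  let _ : InnerProductSpace ℂ Y := InnerProductSpace.ofNorm ℂ hY.parallelogram_identity
  have hpos : 0 ≤ (ContinuousLinearMap.adjoint F ∘L F) :=
    (ContinuousLinearMap.nonneg_iff_isPositive _).2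
      (ContinuousLinearMap.isPositive_adjoint_comp_self F)
  -- The positive square root of `F*F` satisfies `‖Gx‖² = ⟨G²x, x⟩ = ⟨F*Fx, x⟩ = ‖Fx‖²`.
  set G := CFC.sqrt (ContinuousLinearMap.adjoint F ∘L F) with hG
  have hGG : G * G = ContinuousLinearMap.adjoint F ∘L F := CFC.sqrt_mul_sqrt_self _ hpos
  have hGsa : ContinuousLinearMap.adjoint G = G :=
    (IsSelfAdjoint.of_nonneg (CFC.sqrt_nonneg _)).star_eq
  have hn : ∀ x, ‖F x‖ ^ 2 = ‖G x‖ ^ 2 := by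
    intro x
    rw [ContinuousLinearMap.apply_norm_sq_eq_inner_adjoint_left F x,
      ContinuousLinearMap.apply_norm_sq_eq_inner_adjoint_left G x, hGsa, ← hGG]
    rfl
  refine ⟨G, (injective_iff_map_eq_zero _).2 fun x hx => ?_, hn⟩
  have := hn x
  rw [hx, norm_zero] at this
  exact (injective_iff_map_eq_zero _).1 hF x (by simpa using this)

/-- The parallelogram law for the `L²` space of functions with values in a space that satisfies it. -/
theorem innerProductSpaceable_Lp {Ω X : Type*} [MeasurableSpace Ω] (μ : Measure Ω)
    [NormedAddCommGroup X] [NormedSpace ℂ X] (hX : InnerProductSpaceable X) :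
    InnerProductSpaceable (Lp X 2 μ) := by
  let _ : InnerProductSpace ℂ X := InnerProductSpace.ofNorm ℂ hX.parallelogram_identity
  exact ⟨fun x y => by simpa only [← sq] using parallelogram_law_with_norm ℂ x y⟩

end LyapunovFunction

/-! ### The extrapolation space and the mild solution in `X`. -/

section Extrapolation

variable {X U : Type*} [NormedAddCommGroup X] [NormedSpace ℂ X]
  [NormedAddCommGroup U] [NormedSpace ℂ U]

theorem IsResolvent.injective {A : X →ₗ.[ℂ] X} {a : ℂ} {R : X →L[ℂ] X}
    (hR : IsResolvent A a R) : Function.Injective R := by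
  refine (injective_iff_map_eq_zero _).2 fun x hx => ?_
  have h1 := hR.1 x
  rw [hx, smul_zero, zero_sub] at h1
  have h2 := A.graph_fst_eq_zero_snd h1 rfl
  simpa using h2

/-- The generator criterion shows that `T(t)` preserves the domain and commutes with `A`; applying
the left inverse property of `R` to `T(t)Rx` gives the claim. -/
theorem IsResolvent.comm_op {A : X →ₗ.[ℂ] X} {T : C0Semigroup X} (hA : IsGenerator A T) {a : ℂ}
    {R : X →L[ℂ] X} (hR : IsResolvent A a R) {t : ℝ} (ht : 0 ≤ t) :
    R.comp (T.op t) = (T.op t).comp R := by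
  ext x
  have h1 := (hA _ _).1 (hR.1 x)
  have h2 : (T.op t (R x), T.op t (a • R x - x)) ∈ A.graph := by
    rw [hA]
    refine (((T.op t).continuous.tendsto _).comp h1).congr' ?_
    filter_upwards [self_mem_nhdsWithin] with s (hs : 0 < s)
    have e := congrArg (fun L : X →L[ℂ] X => L (R x)) (C0Semigroup.op_comm (T := T) ht hs.le)
    simp only [ContinuousLinearMap.comp_apply] at e
    rw [Function.comp_apply, ContinuousLinearMap.map_smul_of_tower, map_sub, e]
  obtain ⟨y, hy1, hy2⟩ := (LinearPMap.mem_graph_iff A).1 h2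
  have h3 := hR.2 y
  simp only at hy1 hy2
  simp only [hy1, hy2, map_sub, map_smul, sub_sub_cancel] at h3
  exact h3

/-- Strong continuity and a uniform bound on `‖T(t)‖` yield joint continuity. -/
theorem C0Semigroup.continuousOn_op_apply_comp {T : C0Semigroup X} (h : T.IsAnalytic) (hst : T.IsExpStable) {s : Set ℝ}
    {τ : ℝ → ℝ} {v : ℝ → X} (hτ : ContinuousOn τ s) (hτ0 : ∀ r ∈ s, 0 ≤ τ r)
    (hv : ContinuousOn v s) : ContinuousOn (fun r => T.op (τ r) (v r)) s := by
  obtain ⟨M, w, hM, hw, hb⟩ := hst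
  have hb' : ∀ r, 0 ≤ r → ‖T.op r‖ ≤ M := fun r hr => (hb r hr).trans
    (mul_le_of_le_one_right hM.le (Real.exp_le_one_iff.2 (by nlinarith)))
  intro r hr
  have h1 : Tendsto (fun y => T.op (τ y) (v r)) (𝓝[s] r) (𝓝 (T.op (τ r) (v r))) :=
    (h.continuousOn_op_apply (v r)).comp hτ hτ0 r hr
  have h2 : Tendsto (fun y => T.op (τ y) (v y - v r)) (𝓝[s] r) (𝓝 0) := by
    have h3 : Tendsto (fun y => M * ‖v y - v r‖) (𝓝[s] r) (𝓝 0) := by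
      have := ((hv r hr).sub_const (v r)).norm.const_mul M
      simpa using this
    refine squeeze_zero_norm' ?_ h3
    filter_upwards [self_mem_nhdsWithin] with y hy
    exact (ContinuousLinearMap.le_opNorm _ _).trans
      (mul_le_mul_of_nonneg_right (hb' _ (hτ0 y hy)) (norm_nonneg _))
  have := h2.add h1
  simpa [ContinuousWithinAt] using this

theorem resolvent_extension_extrapExt {R S : X →L[ℂ] X} (hRS : ∀ x, R (S x) = S (R x))
    {J : Extrap R →L[ℂ] X} (hJ : ∀ x, J (toExtrap R x) = R x) (z : Extrap R) :
    J (extrapExt R S z) = S (J z) := by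
  induction z using UniformSpace.Completion.induction_on with
  | hp =>
    exact isClosed_eq (J.continuous.comp (extrapExt_uniformContinuous R S).continuous)
      (by fun_prop)
  | ih x =>
    have key : ∀ y : X, J (extrapExt R S (toExtrap R y)) = S (J (toExtrap R y)) := fun y => by
      rw [extrapExt_toExtrap R S hRS, hJ, hJ, hRS]
    exact key x

/-- The operator `(-A)^{-p} B` in `L(U, X)`, read through the isometry `J`. -/
theorem MapsBoundedlyInto.exists_factor {T : C0Semigroup X} {R : X →L[ℂ] X} {p : ℝ}
    {B : U →L[ℂ] Extrap R} (hB : MapsBoundedlyInto T R p B) (hinj : Function.Injective R)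
    (hcomm : ∀ x, R (T.negPow p x) = T.negPow p (R x))
    {J : Extrap R →L[ℂ] X} (hJ : ∀ x, J (toExtrap R x) = R x) :
    ∃ b : U →L[ℂ] X, ∀ v, T.negPow p (J (B v)) = R (b v) := by
  obtain ⟨C, hC⟩ := hB
  choose f hf hfC using hC
  have hf' : ∀ v, R (f v) = T.negPow p (J (B v)) := fun v => by
    rw [← resolvent_extension_extrapExt hcomm hJ, hf, hJ]
  -- Preimages under the injective `R` are unique, so the pointwise choice `f` is automatically
  -- linear.
  let b : U →ₗ[ℂ] X :=
    { toFun := f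
      map_add' := fun v w => hinj (by simp [hf'])
      map_smul' := fun c v => hinj (by simp [hf']) }
  exact ⟨b.mkContinuous C hfC, fun v => (hf' v).symm⟩

variable [CompleteSpace X]

/-- The resolvent extends to an isometry of the extrapolation space into `X`. -/
theorem exists_resolvent_extension (R : X →L[ℂ] X) :
    ∃ J : Extrap R →L[ℂ] X, (∀ x, J (toExtrap R x) = R x) ∧ ∀ z, ‖J z‖ = ‖z‖ := by
  let R₀ : PreExtrap R →L[ℂ] X := (preExtrapMap R).mkContinuous 1 fun x => by
    rw [one_mul]; exact le_rfl
  let J : Extrap R →L[ℂ] X := R₀.extend (UniformSpace.Completion.toComplL (𝕜 := ℂ))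
  have hJ : ∀ x : PreExtrap R, J (x : UniformSpace.Completion (PreExtrap R)) = R₀ x := fun x =>
    ContinuousLinearMap.extend_eq R₀ (e := UniformSpace.Completion.toComplL (𝕜 := ℂ))
      UniformSpace.Completion.denseRange_coe
      (UniformSpace.Completion.isUniformInducing_coe _) x
  refine ⟨J, fun x => hJ x, fun z => ?_⟩
  induction z using UniformSpace.Completion.induction_on with
  | hp => exact isClosed_eq (by fun_prop) (by fun_prop)
  | ih x =>
    rw [hJ, UniformSpace.Completion.norm_coe]
    rfl

namespace C0Semigroup

variable {T : C0Semigroup X}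

theorem intervalIntegrable_fracOp_sub (h : T.IsAnalytic) (hst : T.IsExpStable) {p t : ℝ}
    (h0 : 0 ≤ p) (h1 : p < 1) (ht : 0 ≤ t) {v : ℝ → X} (hv : ContinuousOn v (Icc 0 t)) :
    IntervalIntegrable (fun s => T.fracOp p (t - s) (v s)) volume 0 t := by
  obtain ⟨ω, hω, hb⟩ := exists_norm_fracOp_le h hst
  obtain ⟨K, hK, hb⟩ := hb p h0 h1
  obtain ⟨C, hC⟩ := isCompact_Icc.exists_bound_of_continuousOn hv
  have hi : IntervalIntegrable (fun s : ℝ => (t - s) ^ (-p)) volume 0 t := by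
    have := (intervalIntegral.intervalIntegrable_rpow' (a := 0) (b := t)
      (show -1 < -p by linarith)).comp_sub_left t
    simpa using this.symm
  rw [intervalIntegrable_iff_integrableOn_Ioo_of_le ht] at hi ⊢
  refine Integrable.mono' (hi.const_mul (K * C)) (ContinuousOn.aestronglyMeasurable
    (((continuousOn_fracOp h hst h0 h1).comp (by fun_prop)
      fun s hs => sub_pos.2 hs.2).clm_apply (hv.mono Ioo_subset_Icc_self)) measurableSet_Ioo) ?_
  filter_upwards [ae_restrict_mem measurableSet_Ioo] with s hs
  have hts : 0 < t - s := sub_pos.2 hs.2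
  refine (ContinuousLinearMap.le_opNorm _ _).trans ?_
  have e1 : Real.exp (-ω * (t - s)) ≤ 1 := Real.exp_le_one_iff.2 (by nlinarith)
  have e2 : 0 ≤ (t - s) ^ (-p) := Real.rpow_nonneg hts.le _
  calc ‖T.fracOp p (t - s)‖ * ‖v s‖ ≤ (K * ((t - s) ^ (-p) * 1)) * C := by
        refine mul_le_mul ((hb _ hts).trans ?_) (hC s (Ioo_subset_Icc_self hs)) (norm_nonneg _)
          (by positivity)
        gcongr
    _ = _ := by ring

end C0Semigroup

/-- The input part of the mild solution is the element `∫₀ᵗ (-A)^p T(t-s) (-A)^{-p} B u(s) ds`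
of `X`. -/
theorem toExtrap_integral_fracOp {T : C0Semigroup X} (h : T.IsAnalytic) (hst : T.IsExpStable)
    {R : X →L[ℂ] X} (hcomm : ∀ t, 0 ≤ t → R.comp (T.op t) = (T.op t).comp R)
    {J : Extrap R →L[ℂ] X} (hJ : ∀ x, J (toExtrap R x) = R x) (hJn : ∀ z, ‖J z‖ = ‖z‖)
    {p : ℝ} (h0 : 0 ≤ p) (h1 : p < 1) {B : U →L[ℂ] Extrap R} {b : U →L[ℂ] X}
    (hb : ∀ v, T.negPow p (J (B v)) = R (b v)) {t : ℝ} (ht : 0 ≤ t) {u : ℝ → U}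
    (hu : ContinuousOn u (Icc 0 t)) :
    IntervalIntegrable (inputIntegrand T R B u t) volume 0 t ∧
      toExtrap R (∫ s in (0 : ℝ)..t, T.fracOp p (t - s) (b (u s))) =
        ∫ s in (0 : ℝ)..t, inputIntegrand T R B u t s := by
  have hJi : Isometry J := AddMonoidHomClass.isometry_of_norm J hJn
  have hval : ∀ s ∈ Icc (0 : ℝ) t,
      J (inputIntegrand T R B u t s) = T.op (t - s) (J (B (u s))) := fun s hs =>
    resolvent_extension_extrapExt (fun x => congrArg (fun L : X →L[ℂ] X => L x)
      (hcomm (t - s) (sub_nonneg.2 hs.2))) hJ _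
  -- In `X_{-1}` the integrand has no singularity at `s = t`, and its continuity can be tested after
  -- applying the isometry `J`.
  have hcont : ContinuousOn (inputIntegrand T R B u t) (Icc 0 t) := by
    rw [hJi.isEmbedding.isInducing.continuousOn_iff]
    refine ContinuousOn.congr ?_ hval
    exact C0Semigroup.continuousOn_op_apply_comp h hst (by fun_prop)
      (fun s hs => sub_nonneg.2 hs.2)
      (J.continuous.comp_continuousOn (B.continuous.comp_continuousOn hu))
  have hint : IntervalIntegrable (inputIntegrand T R B u t) volume 0 t :=
    hcont.intervalIntegrable_of_Icc ht
  refine ⟨hint, hJi.injective ?_⟩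
  have hbu : ContinuousOn (fun s => b (u s)) (Icc 0 t) := b.continuous.comp_continuousOn hu
  rw [hJ, ← ContinuousLinearMap.intervalIntegral_comp_comm R
      (C0Semigroup.intervalIntegrable_fracOp_sub h hst h0 h1 ht hbu),
    ← ContinuousLinearMap.intervalIntegral_comp_comm J hint,
    intervalIntegral.integral_of_le ht, intervalIntegral.integral_of_le ht,
    integral_Ioc_eq_integral_Ioo, integral_Ioc_eq_integral_Ioo]
  -- With `τ = t - s > 0`: `R (-A)^p T(τ) b = (-A)^p T(τ) R b = (-A)^p T(τ) (-A)^{-p} J B = T(τ) J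
  -- B`. The endpoint `s = t` is discarded because the identities for `fracOp` need positive time.
  refine setIntegral_congr_fun measurableSet_Ioo fun s hs => ?_
  have hts : 0 < t - s := sub_pos.2 hs.2
  have e1 := C0Semigroup.comp_fracOp_of_comm h hst (S := R) (fun r hr => hcomm r hr.le) h0 h1 hts
  have e2 := C0Semigroup.fracOp_comp_negPow h hst h0 h1 hts
  simp only [hval s (Ioo_subset_Icc_self hs)]
  rw [← ContinuousLinearMap.comp_apply, e1, ContinuousLinearMap.comp_apply, ← hb,
    ← ContinuousLinearMap.comp_apply, e2]

end Extrapolation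

/-! ### Increment of `W_q` along mild solutions. -/

section Dissipation

theorem setIntegral_Ioi_comp_add_right {E : Type*} [NormedAddCommGroup E] [NormedSpace ℝ E]
    (f : ℝ → E) (h : ℝ) : ∫ t in Ioi (0 : ℝ), f (t + h) = ∫ t in Ioi h, f t := by
  have := (measurePreserving_add_right volume h).setIntegral_preimage_emb
    (measurableEmbedding_addRight h) f (Ioi h)
  rwa [preimage_add_const_Ioi, sub_self] at this

namespace C0Semigroup

variable {X : Type*} [NormedAddCommGroup X] [NormedSpace ℂ X]
  {T : C0Semigroup X}

theorem norm_integral_fracOp_le {p ω K : ℝ}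
    (hω : 0 < ω) (hp1 : p < 1) (hK : 0 < K)
    (hbp : ∀ t, 0 < t → ‖T.fracOp p t‖ ≤ K * (t ^ (-p) * Real.exp (-ω * t)))
    {r m : ℝ} (hr : 0 < r) {v : ℝ → X}
    (hm : ∀ s ∈ Icc 0 r, ‖v s‖ ≤ m) :
    ‖∫ s in (0 : ℝ)..r, T.fracOp p (r - s) (v s)‖ ≤ K * m * (r ^ (1 - p) / (1 - p)) := by
  have hi0 : IntervalIntegrable (fun s : ℝ => s ^ (-p)) volume 0 r :=
    intervalIntegral.intervalIntegrable_rpow' (by linarith)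
  have hi : IntervalIntegrable (fun s : ℝ => K * m * (r - s) ^ (-p)) volume 0 r := by
    have := hi0.comp_sub_left r
    rw [sub_zero, sub_self] at this
    exact this.symm.const_mul _
  have h1 : ∫ s in (0 : ℝ)..r, K * m * (r - s) ^ (-p) = K * m * (r ^ (1 - p) / (1 - p)) := by
    rw [intervalIntegral.integral_const_mul,
      intervalIntegral.integral_comp_sub_left (fun s : ℝ => s ^ (-p)) r, sub_self, sub_zero,
      integral_rpow (Or.inl (by linarith)), show -p + 1 = 1 - p by ring,
      Real.zero_rpow (by linarith), sub_zero]
  rw [← h1]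
  refine intervalIntegral.norm_integral_le_of_norm_le hr.le ?_ hi
  filter_upwards [Measure.ae_ne volume r] with s hsr hs
  have hlt : 0 < r - s := sub_pos.2 (lt_of_le_of_ne hs.2 hsr)
  have h3 : 0 ≤ (r - s) ^ (-p) := Real.rpow_nonneg hlt.le _
  have e1 : Real.exp (-ω * (r - s)) ≤ 1 := Real.exp_le_one_iff.2 (by nlinarith)
  have h2 : ‖T.fracOp p (r - s)‖ ≤ K * (r - s) ^ (-p) :=
    (hbp _ hlt).trans (mul_le_mul_of_nonneg_left (mul_le_of_le_one_right h3 e1) hK.le)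
  refine (ContinuousLinearMap.le_opNorm _ _).trans ((mul_le_mul h2
    (hm s (Ioc_subset_Icc_self hs)) (norm_nonneg _) (by positivity)).trans (le_of_eq (by ring)))

theorem tendsto_average_norm_op_sq (h : T.IsAnalytic) (x : X) :
    Tendsto (fun r : ℝ => (∫ t in (0 : ℝ)..r, ‖T.op t x‖ ^ 2) / r) (𝓝[>] 0) (𝓝 (‖x‖ ^ 2)) := by
  have hc : ContinuousOn (fun t => ‖T.op t x‖ ^ 2) (Ici 0) :=
    (h.continuousOn_op_apply x).norm.pow 2
  -- The fundamental theorem of calculus is used one-sidedly, as `T.op` carries no information at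
  -- negative times.
  have hd := intervalIntegral.integral_hasDerivWithinAt_right (a := 0) (b := 0)
    (f := fun t => ‖T.op t x‖ ^ 2) (s := Ici 0) (t := Ioi 0) IntervalIntegrable.refl
    ⟨Ioi 0, self_mem_nhdsWithin,
      (hc.mono Ioi_subset_Ici_self).aestronglyMeasurable measurableSet_Ioi⟩
    ((hc 0 self_mem_Ici).mono Ioi_subset_Ici_self)
  rw [hasDerivWithinAt_iff_tendsto_slope, Ici_sdiff_left] at hd
  simp only [T.op_zero, ContinuousLinearMap.id_apply] at hd
  refine hd.congr fun r => ?_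
  rw [slope_def_field, intervalIntegral.integral_same, sub_zero, sub_zero]

variable [CompleteSpace X]

/-- The bound `‖(-A)^q T(t) (-A)^p T(τ)‖ ≤ C t^{-(p+q)} e^{-ωt}`, uniformly in `τ`. -/
theorem norm_fracOp_comp_fracOp_le (h : T.IsAnalytic) (hst : T.IsExpStable) {p q ω K L : ℝ}
    (hω : 0 < ω) (hp0 : 0 ≤ p) (hp1 : p < 1) (hq0 : 0 ≤ q) (hq1 : q < 1) (hK : 0 < K) (hL : 0 < L)
    (hbp : ∀ t, 0 < t → ‖T.fracOp p t‖ ≤ K * (t ^ (-p) * Real.exp (-ω * t)))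
    (hbq : ∀ t, 0 < t → ‖T.fracOp q t‖ ≤ L * (t ^ (-q) * Real.exp (-ω * t)))
    {t τ : ℝ} (ht : 0 < t) (hτ : 0 < τ) :
    ‖(T.fracOp q t).comp (T.fracOp p τ)‖ ≤
      K * L * 2 ^ (p + q) * (t ^ (-(p + q)) * Real.exp (-ω * t)) := by
  have ht2 : 0 < t / 2 := by positivity
  -- Half of the time `t` is passed to the second factor, whose argument is then at least `t/2`
  -- however small `τ` is.
  have e1 : (T.fracOp q t).comp (T.fracOp p τ) =
      (T.fracOp q (t / 2)).comp (T.fracOp p (t / 2 + τ)) := by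
    rw [← op_comp_fracOp h hst hp0 hp1 ht2.le hτ, ← ContinuousLinearMap.comp_assoc,
      fracOp_comp_op h hst hq0 hq1 ht2.le ht2, add_halves]
  have h1 : ‖T.fracOp p (t / 2 + τ)‖ ≤ K * ((t / 2) ^ (-p) * Real.exp (-ω * (t / 2))) := by
    refine (hbp _ (by positivity)).trans ?_
    have a1 : (t / 2 + τ) ^ (-p) ≤ (t / 2) ^ (-p) :=
      Real.rpow_le_rpow_of_nonpos ht2 (by linarith) (by linarith)
    have a2 : Real.exp (-ω * (t / 2 + τ)) ≤ Real.exp (-ω * (t / 2)) :=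
      Real.exp_le_exp.2 (by nlinarith)
    gcongr
  rw [e1]
  refine (ContinuousLinearMap.opNorm_comp_le _ _).trans
    ((mul_le_mul (hbq _ ht2) h1 (norm_nonneg _) (by positivity)).trans (le_of_eq ?_))
  have e2 : (2 : ℝ) ^ (p + q) * t ^ (-(p + q)) = (t / 2) ^ (-q) * (t / 2) ^ (-p) := by
    rw [← Real.rpow_add ht2, Real.div_rpow ht.le two_pos.le, show -q + -p = -(p + q) by ring,
      Real.rpow_neg two_pos.le, div_inv_eq_mul, mul_comm]
  have e3 : Real.exp (-ω * t) = Real.exp (-ω * (t / 2)) * Real.exp (-ω * (t / 2)) := by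
    rw [← Real.exp_add]; congr 1; ring
  calc _ = K * L * ((t / 2) ^ (-q) * (t / 2) ^ (-p)) *
        (Real.exp (-ω * (t / 2)) * Real.exp (-ω * (t / 2))) := by ring
    _ = _ := by rw [← e2, ← e3]; ring

/-- The singularity is placed on `t` and not on `r - s`, so the bound is linear in `r`, at the price
of the weight `t^{-(p+q)}`. -/
theorem norm_fracOp_integral_le (h : T.IsAnalytic) (hst : T.IsExpStable) {p q ω K L : ℝ}
    (hω : 0 < ω) (hp0 : 0 ≤ p) (hp1 : p < 1) (hq0 : 0 ≤ q) (hq1 : q < 1) (hK : 0 < K) (hL : 0 < L)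
    (hbp : ∀ t, 0 < t → ‖T.fracOp p t‖ ≤ K * (t ^ (-p) * Real.exp (-ω * t)))
    (hbq : ∀ t, 0 < t → ‖T.fracOp q t‖ ≤ L * (t ^ (-q) * Real.exp (-ω * t)))
    {r m : ℝ} (hr : 0 < r) {v : ℝ → X} (hv : ContinuousOn v (Icc 0 r))
    (hm : ∀ s ∈ Icc 0 r, ‖v s‖ ≤ m) {t : ℝ} (ht : 0 < t) :
    ‖T.fracOp q t (∫ s in (0 : ℝ)..r, T.fracOp p (r - s) (v s))‖ ≤
      K * L * 2 ^ (p + q) * (t ^ (-(p + q)) * Real.exp (-ω * t)) * m * r := by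
  rw [← ContinuousLinearMap.intervalIntegral_comp_comm (T.fracOp q t)
    (intervalIntegrable_fracOp_sub h hst hp0 hp1 hr.le hv)]
  have := intervalIntegral.norm_integral_le_of_norm_le_const_ae (a := 0) (b := r)
    (f := fun s => T.fracOp q t (T.fracOp p (r - s) (v s)))
    (C := K * L * 2 ^ (p + q) * (t ^ (-(p + q)) * Real.exp (-ω * t)) * m) ?_
  · rwa [sub_zero, abs_of_pos hr] at this
  · filter_upwards [Measure.ae_ne volume r] with s hsr hs
    rw [uIoc_of_le hr.le] at hs
    have hlt : 0 < r - s := sub_pos.2 (lt_of_le_of_ne hs.2 hsr)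
    have h1 := norm_fracOp_comp_fracOp_le h hst hω hp0 hp1 hq0 hq1 hK hL hbp hbq ht hlt
    rw [← ContinuousLinearMap.comp_apply]
    exact (ContinuousLinearMap.le_opNorm _ _).trans
      (mul_le_mul h1 (hm s (Ioc_subset_Icc_self hs)) (norm_nonneg _)
        ((norm_nonneg _).trans h1))

/-- The increment of the Lyapunov functional along a mild solution. -/
theorem exists_lyap_increment_le (h : T.IsAnalytic) (hst : T.IsExpStable) {p q : ℝ}
    (hp0 : 0 ≤ p) (hp1 : p < 1) (hq0 : 0 ≤ q) (hpq : p + 2 * q < 1) :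
    ∃ N D : ℝ, 0 < N ∧ 0 < D ∧ ∀ (x₀ : X) (v : ℝ → X) (r m : ℝ), 0 < r →
      ContinuousOn v (Icc 0 r) → (∀ s ∈ Icc 0 r, ‖v s‖ ≤ m) →
      lyapW T q (T.op r x₀ + ∫ s in (0 : ℝ)..r, T.fracOp p (r - s) (v s)) ≤
        lyapW T q x₀ - N * (∫ t in (0 : ℝ)..r, ‖T.op t x₀‖ ^ 2) +
          D * (‖x₀‖ * m * r + m ^ 2 * r * r ^ (1 - p)) := by
  have hq1 : q < 1 := by linarith
  obtain ⟨ω, hω, hb⟩ := exists_norm_fracOp_le h hst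
  obtain ⟨K, hK, hbp⟩ := hb p hp0 hp1
  obtain ⟨L, hL, hbq⟩ := hb q hq0 hq1
  obtain ⟨K', -, hint⟩ := exists_integral_norm_fracOp_sq_le h hst hq0 (by linarith : 2 * q < 1)
  set φ : ℝ → ℝ := fun t => t ^ (-(p + 2 * q)) * Real.exp (-(2 * ω) * t) with hφ
  have hφi : IntegrableOn φ (Ioi 0) := integrableOn_rpow_neg_mul_exp hpq (by positivity)
  set I := ∫ t in Ioi (0 : ℝ), φ t with hI
  have hI0 : 0 ≤ I := setIntegral_nonneg measurableSet_Ioi fun t (ht : 0 < t) =>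
    mul_nonneg (Real.rpow_nonneg ht.le _) (Real.exp_pos _).le
  have hp1' : 0 < 1 - p := by linarith
  set c := K * L * 2 ^ (p + q) with hc
  have hcpos : 0 < c := by positivity
  set D := 2 * L * c + c * (L * K / (1 - p)) with hD
  have hDpos : 0 < D := by positivity
  -- This gives `‖T(t)x₀‖ ≤ M ‖(-A)^q T(t)x₀‖`, the source of the negative term.
  set M := ‖T.negPow q‖ + 1 with hM
  have hMpos : 0 < M := by positivity
  refine ⟨(M ^ 2)⁻¹, D * (I + 1), by positivity, by positivity, ?_⟩
  intro x₀ v r m hr hv hm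
  have hm0 : 0 ≤ m := (norm_nonneg _).trans (hm 0 ⟨le_rfl, hr.le⟩)
  set y := ∫ s in (0 : ℝ)..r, T.fracOp p (r - s) (v s) with hy
  set E := ‖x₀‖ * m * r + m ^ 2 * r * r ^ (1 - p) with hE
  have hE0 : 0 ≤ E := by positivity
  have hpt : ∀ t, 0 < t → ‖T.fracOp q t (T.op r x₀ + y)‖ ^ 2 ≤
      ‖T.fracOp q (t + r) x₀‖ ^ 2 + D * E * φ t := by
    intro t ht
    have e0 : T.fracOp q t (T.op r x₀) = T.fracOp q (t + r) x₀ := by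
      rw [← ContinuousLinearMap.comp_apply, fracOp_comp_op h hst hq0 hq1 hr.le ht, add_comm]
    set f := t ^ (-(p + q)) * Real.exp (-ω * t) with hf
    set g := t ^ (-q) * Real.exp (-ω * t) with hg
    have hf0 : 0 ≤ f := mul_nonneg (Real.rpow_nonneg ht.le _) (Real.exp_pos _).le
    have hg0 : 0 ≤ g := mul_nonneg (Real.rpow_nonneg ht.le _) (Real.exp_pos _).le
    have hfg : φ t = f * g := by
      have e1 : t ^ (-(p + 2 * q)) = t ^ (-(p + q)) * t ^ (-q) := by
        rw [← Real.rpow_add ht]; congr 1; ring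
      have e2 : Real.exp (-(2 * ω) * t) = Real.exp (-ω * t) * Real.exp (-ω * t) := by
        rw [← Real.exp_add]; congr 1; ring
      rw [hφ, hf, hg]
      simp only [e1, e2]
      ring
    -- Two bounds for the same quantity: `hA` is linear in `r` with weight `t^{-(p+q)}`, `hB` is of
    -- order `r^{1-p}` with weight `t^{-q}`. In the square one factor is estimated by each. Using
    -- `hA` twice could lose integrability at `t = 0`, and using `hB` twice would give only
    -- `r^{2-2p}`, not `o(r)` for `p ≥ 1/2`. The product is `r^{2-p}` with the integrable weight
    -- `φ`.
    have hA : ‖T.fracOp q t y‖ ≤ c * f * m * r :=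
      norm_fracOp_integral_le h hst hω hp0 hp1 hq0 hq1 hK hL hbp hbq hr hv hm ht
    have hB : ‖T.fracOp q t y‖ ≤ L * g * (K * m * (r ^ (1 - p) / (1 - p))) :=
      (ContinuousLinearMap.le_opNorm _ _).trans (mul_le_mul (hbq t ht)
        (norm_integral_fracOp_le hω hp1 hK hbp hr hm) (norm_nonneg _) (by positivity))
    have hC : ‖T.fracOp q (t + r) x₀‖ ≤ L * g * ‖x₀‖ := by
      refine (ContinuousLinearMap.le_opNorm _ _).trans
        (mul_le_mul_of_nonneg_right ((hbq (t + r) (by positivity)).trans ?_) (norm_nonneg _))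
      have a1 : (t + r) ^ (-q) ≤ t ^ (-q) :=
        Real.rpow_le_rpow_of_nonpos ht (by linarith) (by linarith)
      have a2 : Real.exp (-ω * (t + r)) ≤ Real.exp (-ω * t) :=
        Real.exp_le_exp.2 (by nlinarith)
      rw [hg]
      gcongr
    have h1 : ‖T.fracOp q t (T.op r x₀ + y)‖ ≤ ‖T.fracOp q (t + r) x₀‖ + ‖T.fracOp q t y‖ := by
      rw [map_add, e0]; exact norm_add_le _ _
    have h2 : ‖T.fracOp q (t + r) x₀‖ * ‖T.fracOp q t y‖ ≤ L * g * ‖x₀‖ * (c * f * m * r) :=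
      mul_le_mul hC hA (norm_nonneg _) (by positivity)
    have h3 : ‖T.fracOp q t y‖ * ‖T.fracOp q t y‖ ≤
        c * f * m * r * (L * g * (K * m * (r ^ (1 - p) / (1 - p)))) :=
      mul_le_mul hA hB (norm_nonneg _) (by positivity)
    have h4 := pow_le_pow_left₀ (norm_nonneg _) h1 2
    have h5 : 2 * (L * g * ‖x₀‖ * (c * f * m * r)) +
        c * f * m * r * (L * g * (K * m * (r ^ (1 - p) / (1 - p)))) ≤ D * E * φ t := by
      have e3 : 2 * (L * g * ‖x₀‖ * (c * f * m * r)) +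
          c * f * m * r * (L * g * (K * m * (r ^ (1 - p) / (1 - p)))) =
          (2 * L * c * (‖x₀‖ * m * r) +
            c * (L * K / (1 - p)) * (m ^ 2 * r * r ^ (1 - p))) * (f * g) := by ring
      rw [e3, hfg]
      refine mul_le_mul_of_nonneg_right ?_ (mul_nonneg hf0 hg0)
      have i1 : 0 ≤ 2 * L * c * (m ^ 2 * r * r ^ (1 - p)) := by positivity
      have i2 : 0 ≤ c * (L * K / (1 - p)) * (‖x₀‖ * m * r) := by positivity
      rw [hD, hE]
      linarith
    nlinarith
  have hshift : IntegrableOn (fun t => ‖T.fracOp q (t + r) x₀‖ ^ 2) (Ioi 0) := by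
    refine (hint (T.op r x₀)).1.congr_fun (fun t (ht : 0 < t) => ?_) measurableSet_Ioi
    simp only
    rw [← ContinuousLinearMap.comp_apply, fracOp_comp_op h hst hq0 hq1 hr.le ht, add_comm]
  have hW : lyapW T q (T.op r x₀ + y) ≤
      (∫ t in Ioi r, ‖T.fracOp q t x₀‖ ^ 2) + D * E * I := by
    rw [lyapW_eq h hst hq0 hq1, ← setIntegral_Ioi_comp_add_right (fun t => ‖T.fracOp q t x₀‖ ^ 2), hI, ← integral_const_mul,
      ← integral_add hshift (hφi.const_mul _)]
    exact setIntegral_mono_on (hint _).1 (hshift.add (hφi.const_mul _)) measurableSet_Ioi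
      fun t ht => hpt t ht
  -- The free motion leaves only the tail beyond `r`; the missing piece over `(0, r)` is the
  -- dissipated amount.
  have hsub := intervalIntegral.integral_Ioi_sub_Ioi (hint x₀).1 hr.le
  have hlow : (M ^ 2)⁻¹ * (∫ t in (0 : ℝ)..r, ‖T.op t x₀‖ ^ 2) ≤
      ∫ t in (0 : ℝ)..r, ‖T.fracOp q t x₀‖ ^ 2 := by
    rw [← intervalIntegral.integral_const_mul, intervalIntegral.integral_of_le hr.le,
      intervalIntegral.integral_of_le hr.le]
    have hi1 : IntegrableOn (fun t => (M ^ 2)⁻¹ * ‖T.op t x₀‖ ^ 2) (Ioc 0 r) :=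
      (ContinuousOn.integrableOn_Icc (continuousOn_const.mul
        (((h.continuousOn_op_apply x₀).mono Icc_subset_Ici_self).norm.pow 2))).mono_set
        Ioc_subset_Icc_self
    refine setIntegral_mono_on hi1 ((hint x₀).1.mono_set Ioc_subset_Ioi_self) measurableSet_Ioc
      fun t ht => ?_
    rw [inv_mul_le_iff₀ (by positivity), ← mul_pow]
    refine pow_le_pow_left₀ (norm_nonneg _) ?_ 2
    rw [← negPow_comp_fracOp h hst hq0 hq1 ht.1, ContinuousLinearMap.comp_apply]
    exact (ContinuousLinearMap.le_opNorm _ _).trans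
      (mul_le_mul_of_nonneg_right (by linarith) (norm_nonneg _))
  have hDE : 0 ≤ D * E := by positivity
  rw [lyapW_eq h hst hq0 hq1 x₀]
  linarith

end C0Semigroup

end Dissipation

/-! ### The Dini estimate and assembly of the result. -/

section Main

variable {X U : Type*} [NormedAddCommGroup X] [NormedSpace ℂ X] [CompleteSpace X]
  [NormedAddCommGroup U] [NormedSpace ℂ U]

/-- The Dini derivative estimate for the input term `∫₀ʰ (-A)^p T(h-s) b u(s) ds`. -/
theorem exists_dissipation {T : C0Semigroup X} (h : T.IsAnalytic) (hst : T.IsExpStable)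
    {p q : ℝ} (hp0 : 0 ≤ p) (hp1 : p < 1) (hq0 : 0 ≤ q) (hpq : p + 2 * q < 1) (b : U →L[ℂ] X) :
    ∃ a₃ a₄ : ℝ, 0 < a₃ ∧ 0 < a₄ ∧ ∀ (x₀ : X) (u : ℝ → U) (x : ℝ → X),
      ContinuousOn u (Ici 0) →
      (∀ r, 0 < r → x r = T.op r x₀ + ∫ s in (0 : ℝ)..r, T.fracOp p (r - s) (b (u s))) →
      diniDeriv (lyapW T q) x x₀ ≤ ((-a₃ * ‖x₀‖ ^ 2 + a₄ * ‖u 0‖ ^ 2 : ℝ) : EReal) := by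
  obtain ⟨N, D, hN, hD, hinc⟩ := C0Semigroup.exists_lyap_increment_le h hst hp0 hp1 hq0 hpq
  set k := D * ‖b‖ with hk
  have hk0 : 0 ≤ k := by positivity
  -- These constants come from Young's inequality on `k ‖x₀‖ ‖u 0‖`, spending half of `N`; the `1`
  -- keeps `a₄` positive by an explicit margin.
  refine ⟨N / 2, k ^ 2 / (2 * N) + 1, by positivity, by positivity, fun x₀ u x hu hx => ?_⟩
  -- By continuity `‖u‖` stays below `‖u 0‖ + δ` on a short interval. The term quadratic in `m`
  -- carries `r^{1-p} → 0`, so only the linear one survives; `δ → 0` follows afterwards.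
  have key : ∀ δ : ℝ, 0 < δ → diniDeriv (lyapW T q) x x₀ ≤
      ((-N * ‖x₀‖ ^ 2 + k * ‖x₀‖ * (‖u 0‖ + δ) : ℝ) : EReal) := by
    intro δ hδ
    set m := ‖b‖ * (‖u 0‖ + δ) with hm
    have hm0 : 0 ≤ m := by positivity
    set g : ℝ → ℝ := fun r => -N * ((∫ t in (0 : ℝ)..r, ‖T.op t x₀‖ ^ 2) / r) +
      D * (‖x₀‖ * m + m ^ 2 * r ^ (1 - p)) with hg
    have hlim : Tendsto g (𝓝[>] 0) (𝓝 (-N * ‖x₀‖ ^ 2 + k * ‖x₀‖ * (‖u 0‖ + δ))) := by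
      have h1 : Tendsto (fun r : ℝ => r ^ (1 - p)) (𝓝[>] 0) (𝓝 0) := by
        have := (Real.continuousAt_rpow_const 0 (1 - p) (Or.inr (by linarith))).tendsto
        rw [Real.zero_rpow (by linarith)] at this
        exact this.mono_left nhdsWithin_le_nhds
      have h2 := ((C0Semigroup.tendsto_average_norm_op_sq h x₀).const_mul (-N)).add
        (((h1.const_mul (m ^ 2)).const_add (‖x₀‖ * m)).const_mul D)
      convert h2 using 2
      rw [hk, hm]
      ring
    have hle : ∀ᶠ r in 𝓝[>] (0 : ℝ), (lyapW T q (x r) - lyapW T q x₀) / r ≤ g r := by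
      have h3 : ∀ᶠ s in 𝓝[≥] (0 : ℝ), ‖u s‖ < ‖u 0‖ + δ :=
        (hu 0 self_mem_Ici).norm.eventually_lt_const (by linarith)
      obtain ⟨ε, hε, h3⟩ := (mem_nhdsGE_iff_exists_Icc_subset).1 h3
      filter_upwards [Ioc_mem_nhdsGT hε] with r hr
      have hrpos : 0 < r := hr.1
      have h4 := hinc x₀ (fun s => b (u s)) r m hrpos
        (b.continuous.comp_continuousOn (hu.mono Icc_subset_Ici_self)) fun s hs =>
          (b.le_opNorm _).trans (mul_le_mul_of_nonneg_left
            (h3 ⟨hs.1, hs.2.trans hr.2⟩).le (norm_nonneg _))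
      rw [← hx r hrpos] at h4
      rw [div_le_iff₀ hrpos]
      have e : g r * r = -(N * ∫ t in (0 : ℝ)..r, ‖T.op t x₀‖ ^ 2) +
          D * (‖x₀‖ * m * r + m ^ 2 * r * r ^ (1 - p)) := by
        rw [hg]
        field_simp
      rw [e]
      linarith
    calc diniDeriv (lyapW T q) x x₀ ≤ limsup (fun r => ((g r : ℝ) : EReal)) (𝓝[>] 0) :=
          limsup_le_limsup (hle.mono fun r hr => EReal.coe_le_coe_iff.2 hr)
      _ = _ := ((continuous_coe_real_ereal.tendsto _).comp hlim).limsup_eq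
  have h5 : diniDeriv (lyapW T q) x x₀ ≤
      ((-N * ‖x₀‖ ^ 2 + k * ‖x₀‖ * (‖u 0‖ + 0) : ℝ) : EReal) := by
    have h6 : Tendsto (fun δ : ℝ => ((-N * ‖x₀‖ ^ 2 + k * ‖x₀‖ * (‖u 0‖ + δ) : ℝ) : EReal))
        (𝓝[>] 0) (𝓝 ((-N * ‖x₀‖ ^ 2 + k * ‖x₀‖ * (‖u 0‖ + 0) : ℝ) : EReal)) := by
      refine (continuous_coe_real_ereal.tendsto _).comp (Tendsto.mono_left ?_ nhdsWithin_le_nhds)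
      exact Continuous.tendsto (by fun_prop) 0
    refine ge_of_tendsto h6 ?_
    filter_upwards [self_mem_nhdsWithin] with δ hδ using key δ hδ
  refine h5.trans (EReal.coe_le_coe_iff.2 ?_)
  have h7 : k * ‖x₀‖ * ‖u 0‖ ≤ N / 2 * ‖x₀‖ ^ 2 + k ^ 2 / (2 * N) * ‖u 0‖ ^ 2 := by
    have : N / 2 * ‖x₀‖ ^ 2 + k ^ 2 / (2 * N) * ‖u 0‖ ^ 2 - k * ‖x₀‖ * ‖u 0‖ =
        (N * ‖x₀‖ - k * ‖u 0‖) ^ 2 / (2 * N) := by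
      field_simp
      ring
    have h8 : 0 ≤ (N * ‖x₀‖ - k * ‖u 0‖) ^ 2 / (2 * N) := by positivity
    linarith
  have h9 : 0 ≤ ‖u 0‖ ^ 2 := by positivity
  linarith

theorem isClassKInf_mul_sq {c : ℝ} (hc : 0 < c) : IsClassKInf fun r => c * r ^ 2 := by
  refine ⟨by fun_prop, fun r hr s _ hrs => ?_, by simp,
    (tendsto_pow_atTop two_ne_zero).const_mul_atTop hc⟩
  have hr : 0 ≤ r := hr
  have := pow_lt_pow_left₀ hrs hr two_ne_zero
  exact mul_lt_mul_of_pos_left this hc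

end Main

theorem mainTheorem6 {X U : Type*}
    [NormedAddCommGroup X] [NormedSpace ℂ X] [CompleteSpace X]
    [NormedAddCommGroup U] [NormedSpace ℂ U] [CompleteSpace U]
    (A : X →ₗ.[ℂ] X) (T : C0Semigroup X) (hA : IsGenerator A T)
    (hstab : T.IsExpStable) (hanalytic : T.IsAnalytic)
    (a : ℂ) (R : X →L[ℂ] X) (hR : IsResolvent A a R)
    (p : ℝ) (hp0 : 0 ≤ p) (hp1 : p < 1)
    (B : U →L[ℂ] Extrap R) (hB : MapsBoundedlyInto T R p B)
    (q : ℝ) (hq : 0 ≤ q) (hpq : p + 2 * q < 1) :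
    (∀ x : X, (∀ t : ℝ, 0 < t → T.op t x ∈ (T.posPow q).domain) ∧
      IntegrableOn (fun t : ℝ => ‖T.posPowApply q (T.op t x)‖ ^ 2) (Ioi 0)) ∧
    IsLrISSLyapunov T R B 2 (lyapW T q) ∧
    (∃ F : X →L[ℂ] Lp X 2 (volume.restrict (Ioi (0 : ℝ))), Function.Injective F ∧
      (∀ x : X, (F x : ℝ → X) =ᵐ[volume.restrict (Ioi (0 : ℝ))]
        fun t => T.posPowApply q (T.op t x)) ∧
      ∀ x : X, lyapW T q x = ‖F x‖ ^ 2) ∧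
    (InnerProductSpaceable X →
      ∃ F : X →L[ℂ] X, Function.Injective F ∧ ∀ x : X, lyapW T q x = ‖F x‖ ^ 2) := by
  have hq1 : q < 1 := by linarith
  have h2q : 2 * q < 1 := by linarith
  have hpow := fun (t : ℝ) (ht : 0 < t) (x : X) =>
    C0Semigroup.op_mem_posPow_domain hanalytic hstab hq hq1 ht x
  obtain ⟨F, hF, hFn⟩ := C0Semigroup.exists_lyapOp hanalytic hstab hq h2q
  have hFinj : Function.Injective F := C0Semigroup.lyapOp_injective hanalytic hstab hq hq1 hF
  obtain ⟨K, -, hK⟩ := C0Semigroup.exists_integral_norm_fracOp_sq_le hanalytic hstab hq h2q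
  have hcomm : ∀ t, 0 ≤ t → R.comp (T.op t) = (T.op t).comp R := fun t ht => hR.comm_op hA ht
  obtain ⟨J, hJ, hJn⟩ := exists_resolvent_extension R
  have hcommp : ∀ x, R (T.negPow p x) = T.negPow p (R x) := fun x =>
    congrArg (fun L : X →L[ℂ] X => L x)
      (C0Semigroup.comp_negPow_of_comm hanalytic hstab (fun t ht => hcomm t ht.le) hp0)
  obtain ⟨b, hb⟩ := hB.exists_factor hR.injective hcommp hJ
  have hext : Function.Injective (toExtrap R) := fun x y hxy =>
    hR.injective (by rw [← hJ, ← hJ, hxy])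
  have hsol := fun (t : ℝ) (ht : 0 ≤ t) (u : ℝ → U) (hu : ContinuousOn u (Icc 0 t)) =>
    toExtrap_integral_fracOp hanalytic hstab hcomm hJ hJn hp0 hp1 hb ht hu
  obtain ⟨a₃, a₄, ha₃, ha₄, hdis⟩ := exists_dissipation hanalytic hstab hp0 hp1 hq hpq b
  refine ⟨fun x => ⟨fun t ht => (hpow t ht x).1, ?_⟩, ⟨?_, ?_, ?_, ?_, ?_⟩,
    ⟨F, hFinj, fun x => ?_, hFn⟩, fun hX => ?_⟩
  · exact (hK x).1.congr_fun (fun t ht => by simp only [(hpow t ht x).2]) measurableSet_Ioi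
  · exact fun t ht u hu => ⟨(hsol t ht u hu).1, _, (hsol t ht u hu).2⟩
  · simp only [funext hFn]
    fun_prop
  · exact fun x => by rw [hFn]; positivity
  · refine ⟨fun r => (‖F‖ ^ 2 + 1) * r ^ 2, isClassKInf_mul_sq (by positivity), fun x hx => ?_⟩
    rw [hFn]
    have hne : F x ≠ 0 := (map_ne_zero_iff F hFinj).2 hx
    refine ⟨by positivity, ?_⟩
    calc ‖F x‖ ^ 2 ≤ (‖F‖ * ‖x‖) ^ 2 := pow_le_pow_left₀ (norm_nonneg _) (F.le_opNorm x) 2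
      _ = ‖F‖ ^ 2 * ‖x‖ ^ 2 := mul_pow _ _ _
      _ ≤ _ := mul_le_mul_of_nonneg_right (by linarith) (sq_nonneg _)
  · refine ⟨a₃, a₄, ha₃, ha₄, fun x₀ u x hu hx => ?_⟩
    rw [Real.rpow_two]
    -- The mild solution is prescribed only in `X_{-1}`; injectivity of the embedding identifies it
    -- with the explicit formula in `X`.
    refine hdis x₀ u x hu fun r hr => hext ?_
    have h1 := hsol r hr.le u (hu.mono Icc_subset_Ici_self)
    rw [hx r hr.le, ← h1.2]
    exact (UniformSpace.Completion.coe_add (α := PreExtrap R) _ _).symm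
  · filter_upwards [hF x, ae_restrict_mem measurableSet_Ioi] with t h1 h2
    rw [h1, (hpow t h2 x).2]
  · obtain ⟨G, hG, hGn⟩ := exists_norm_sq_eq_of_innerProductSpaceable hX
      (innerProductSpaceable_Lp _ hX) F hFinj
    exact ⟨G, hG, fun x => (hFn x).trans (hGn x)⟩
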